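/- **Theorem.** There is an absolute constant $C>0$ with the following property. Consider networks $f_W(x)=\sigma_L(W_L\sigma_{L-1}(W_{L-1}\cdots\sigma_1(W_1x)\cdots))$ with weight matrices $W_l\in\mathbb R^{m_l\times m_{l-1}}$, where $m_0=d$, $m_L=k$ and $\bar m=\max\{m_0,\dots,m_L\}$, and with fixed activation maps $\sigma_l:\mathbb R^{m_l}\to\mathbb R^{m_l}$ that are $\rho_l$-Lipschitz in the Euclidean norm and satisfy $\sigma_l(0)=0$. Let $s_l>0$ and $a_l\ge 0$ for $l=1,\dots,L$, and let $\mathcal W$ be the set of all $W=(W_1,\dots,W_L)$ such that, for every $l$, $\|W_l\|_\sigma\le s_l$ (spectral norm) and $\|W_l\|_1\le a_l$ (entrywise $\ell_1$ norm). Let $\mathcal B(x)\subseteq\mathbb R^d$ be an arbitrary nonempty perturbation set for each $x\in\mathbb R^d$, let $\mathcal D$ be any probability distribution on $\mathbb R^d\times\{1,\dots,k\}$, let $n\ge1$ and $\delta\in(0,1)$, and let $\mathcal S=\{(x_i,y_i)\}_{i=1}^n$ be drawn i.i.d. from $\mathcal D$. For $r\ge 0$ and $\tilde B\ge 0$ put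 $$\Phi(\tilde B,r)=C\left(\frac{\tilde B\,r\prod_{i=1}^L\rho_is_i}{\sqrt n}\Big(\sum_{i=1}^L\frac{a_i^{2/3}}{s_i^{2/3}}\Big)^{3/2}(1+\ln n)\sqrt{\ln(2\bar m^2)}+\sqrt{\frac{\ln(1/\delta)}{n}}\right).$$ (1) Let the loss $\ell:\mathbb R^k\times\{1,\dots,k\}\to[0,1]$ be $\rho$-Lipschitz in its first argument with respect to the Euclidean norm, and suppose that the robust loss $(x,y)\mapsto\sup_{x'\in\mathcal B(x)}\ell(f_W(x'),y)$ is $\mathcal D$-measurable for every $W\in\mathcal W$. Then with probability at least $1-\delta$ over $\mathcal S$, simultaneously for all $W\in\mathcal W$ and all $\tilde B$ with $\|x'\|_2\le\tilde B$ for every $x'\in\mathcal B(x_i)$, $i=1,\dots,n$, $$\mathbb E_{(x,y)\sim\mathcal D}\sup_{x'\in\mathcal B(x)}\ell(f_W(x'),y)-\frac1n\sum_{i=1}^n\sup_{x'\in\mathcal B(x_i)}\ell(f_W(x'),y_i)\le\Phi(\tilde B,\rho).$$ (2) Let $\gamma>0$, let $\arg\max$ be taken with any fixed tie-breaking rule,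 and suppose that the events $\{(x,y):\exists x'\in\mathcal B(x),\ f_W(x')_y\le t+\max_{j\ne y}f_W(x')_j\}$ are $\mathcal D$-measurable for all $W\in\mathcal W$ and $0\le t\le\gamma$. Then with probability at least $1-\delta$ over $\mathcal S$, simultaneously for all $W\in\mathcal W$ and all $\tilde B$ as in (1), $$\mathbb P_{(x,y)\sim\mathcal D}\{\exists x'\in\mathcal B(x):\ y\ne\arg\max_jf_W(x')_j\}-\frac1n\sum_{i=1}^n\mathbf 1\Big(\exists x'\in\mathcal B(x_i):\ f_W(x')_{y_i}\le\gamma+\max_{j\ne y_i}f_W(x')_j\Big)\le\Phi(\tilde B,1/\gamma).$$ (If the first event is not measurable, its probability is read as outer probability; a maximum over the empty set is $-\infty$.) -/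

import Mathlib

open MeasureTheory
open scoped NNReal BigOperators

noncomputable section

namespace RobustNet

/-- The Euclidean space of dimension `d`, carrying the `ℓ²` norm. -/
abbrev Vec (d : ℕ) : Type := EuclideanSpace ℝ (Fin d)

/-- Weight matrices of a network with `L` layers and widths `m 0, …, m L`. -/
abbrev Weights {L : ℕ} (m : Fin (L + 1) → ℕ) : Type :=
  (i : Fin L) → Matrix (Fin (m i.succ)) (Fin (m i.castSucc)) ℝ

/-- Activations: one map on each of the spaces of dimensions `m 1, …, m L`. -/
abbrev Activations {L : ℕ} (m : Fin (L + 1) → ℕ) : Type :=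
  (i : Fin L) → Vec (m i.succ) → Vec (m i.succ)

/-- A labelled example: an input of dimension `m 0` and one of `m L` class labels. -/
abbrev Example {L : ℕ} (m : Fin (L + 1) → ℕ) : Type :=
  Vec (m 0) × Fin (m (Fin.last L))

/-- The spectral norm of a matrix: its operator norm with respect to Euclidean norms. -/
def matSpectralNorm {p q : ℕ} (A : Matrix (Fin p) (Fin q) ℝ) : ℝ :=
  ‖LinearMap.toContinuousLinearMap (Matrix.toEuclideanLin A)‖

/-- The entrywise `ℓ¹` norm of a matrix. -/
def entrywiseL1 {p q : ℕ} (A : Matrix (Fin p) (Fin q) ℝ) : ℝ :=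
  ∑ i, ∑ j, |A i j|

/-- The output of the first `i` layers: `x ↦ σ_i (W_i (⋯ σ_1 (W_1 x) ⋯))`. -/
def layerOutput {L : ℕ} {m : Fin (L + 1) → ℕ} (σ : Activations m) (W : Weights m) :
    (i : Fin (L + 1)) → Vec (m 0) → Vec (m i) :=
  Fin.induction (motive := fun i => Vec (m 0) → Vec (m i)) id
    (fun i g x => σ i (Matrix.toEuclideanLin (W i) (g x)))

/-- The network `x ↦ σ_L (W_L (σ_{L-1} (W_{L-1} ⋯ σ_1 (W_1 x) ⋯)))`. -/
def net {L : ℕ} {m : Fin (L + 1) → ℕ} (σ : Activations m) (W : Weights m) :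
    Vec (m 0) → Vec (m (Fin.last L)) :=
  layerOutput σ W (Fin.last L)

/-- Weights whose layers obey the spectral norm bounds `s` and the `ℓ¹` norm bounds `a`. -/
def weightClass {L : ℕ} (m : Fin (L + 1) → ℕ) (s a : Fin L → ℝ) : Set (Weights m) :=
  {W | ∀ i, matSpectralNorm (W i) ≤ s i ∧ entrywiseL1 (W i) ≤ a i}

/-- The robust loss `(x, y) ↦ sup_{x' ∈ B x} ℓ(f x', y)`. -/
def robustLoss {L : ℕ} {m : Fin (L + 1) → ℕ}
    (loss : Vec (m (Fin.last L)) → Fin (m (Fin.last L)) → ℝ)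
    (B : Vec (m 0) → Set (Vec (m 0))) (σ : Activations m) (W : Weights m)
    (p : Example m) : ℝ :=
  ⨆ x' : B p.1, loss (net σ W x') p.2

/-- The robust generalization gap: robust population risk minus robust empirical risk. -/
def robustGap {L n : ℕ} {m : Fin (L + 1) → ℕ}
    (loss : Vec (m (Fin.last L)) → Fin (m (Fin.last L)) → ℝ)
    (B : Vec (m 0) → Set (Vec (m 0))) (σ : Activations m) (D : Measure (Example m))
    (S : Fin n → Example m) (W : Weights m) : ℝ :=
  (∫ p, robustLoss loss B σ W p ∂D) - (1 / (n : ℝ)) * ∑ i, robustLoss loss B σ W (S i)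

/-- Examples `(x, y)` for which some `x' ∈ B x` is misclassified by the rule `pick`. -/
def robustErrorSet {L : ℕ} {m : Fin (L + 1) → ℕ}
    (pick : Vec (m (Fin.last L)) → Fin (m (Fin.last L)))
    (B : Vec (m 0) → Set (Vec (m 0))) (σ : Activations m) (W : Weights m) :
    Set (Example m) :=
  {p | ∃ x' ∈ B p.1, p.2 ≠ pick (net σ W x')}

/-- Examples `(x, y)` such that `f(x')_y ≤ t + max_{j ≠ y} f(x')_j` for some `x' ∈ B x`
(the maximum is `-∞` if there is only one class). -/
def robustMarginErrorSet {L : ℕ} {m : Fin (L + 1) → ℕ}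
    (B : Vec (m 0) → Set (Vec (m 0))) (σ : Activations m) (t : ℝ) (W : Weights m) :
    Set (Example m) :=
  {p | ∃ x' ∈ B p.1, ∃ j, j ≠ p.2 ∧ net σ W x' p.2 ≤ t + net σ W x' j}

/-- The robust margin gap: robust population classification error minus empirical robust
margin error at margin `γ`. -/
def robustMarginGap {L n : ℕ} {m : Fin (L + 1) → ℕ}
    (pick : Vec (m (Fin.last L)) → Fin (m (Fin.last L)))
    (B : Vec (m 0) → Set (Vec (m 0))) (σ : Activations m) (γ : ℝ) (D : Measure (Example m))
    (S : Fin n → Example m) (W : Weights m) : ℝ :=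
  D.real (robustErrorSet pick B σ W) -
    (1 / (n : ℝ)) * ∑ i, (robustMarginErrorSet B σ γ W).indicator (fun _ => (1 : ℝ)) (S i)

/-- `Btil` bounds the `ℓ²` norm of all adversarial examples of the sample `S`. -/
def BoundsAdversarial {L n : ℕ} {m : Fin (L + 1) → ℕ}
    (B : Vec (m 0) → Set (Vec (m 0))) (S : Fin n → Example m) (Btil : ℝ) : Prop :=
  ∀ i, ∀ x' ∈ B (S i).1, ‖x'‖ ≤ Btil

/-- The largest width `max {m 0, …, m L}`. -/
def maxWidth {L : ℕ} (m : Fin (L + 1) → ℕ) : ℕ := Finset.univ.sup m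

/-- The leading term
`Btil * r * (∏ ρ_i s_i) * (∑ (a_i / s_i)^(2/3))^(3/2) / √n`. -/
def leadingTerm {L : ℕ} (n : ℕ) (Btil r : ℝ) (ρ s a : Fin L → ℝ) : ℝ :=
  Btil * r * (∏ i, ρ i * s i) / √(n : ℝ) *
    (∑ i, a i ^ (2 / 3 : ℝ) / s i ^ (2 / 3 : ℝ)) ^ (3 / 2 : ℝ)

/-- The logarithmic factor `(1 + ln n) √(ln (2 M²))` for sample size `n` and width `M`. -/
def logFactor (n M : ℕ) : ℝ :=
  (1 + Real.log n) * √(Real.log (2 * (M : ℝ) ^ 2))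

end RobustNet

end

/-!
Uniform deviations are controlled by symmetrization and McDiarmid's inequality. Since the radius
`Btil` is chosen after the sample, McDiarmid's inequality is applied to the largest difference
between the deviation of a member of the class and the Rademacher complexity on the sample, which
has bounded differences: this keeps the complexity empirical, and hence in terms of `Btil`.

The complexity is bounded by chaining. Sparsifying each layer by Maurey's lemma yields nets of the
`ℓ¹` balls for the Frobenius distance, and on an input of norm at most `Btil` the loss is Lipschitz
in the weights, also after the supremum over the perturbations. Optimizing the numbers of atoms
given to the layers produces the factor `(∑ (a_l / s_l)^(2/3))^(3/2)`.

Only countably many weights are compared with their means; the others follow by a limit along which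
the risk is lower semicontinuous and the empirical risk is continuous. The margin bound is the
bound for the ramp loss.
-/

namespace RobustNet

section RademacherComplexity

variable {ι : Type*} [Fintype ι]

/-- The correlation `∑ eᵢ xᵢ` of a vector with a sign pattern; signs are units of `ℤ`. -/
def signedSum (e : ι → ℤˣ) (x : ι → ℝ) : ℝ := ∑ i, e i • x i

theorem signedSum_neg_left (e : ι → ℤˣ) (x : ι → ℝ) : signedSum (-e) x = -signedSum e x := by
  simp [signedSum]

theorem signedSum_sub (e : ι → ℤˣ) (x y : ι → ℝ) :
    signedSum e (x - y) = signedSum e x - signedSum e y := by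
  simp [signedSum, smul_sub]

theorem signedSum_smul (e : ι → ℤˣ) (c : ℝ) (x : ι → ℝ) :
    signedSum e (c • x) = c * signedSum e x := by
  simp only [signedSum, Finset.mul_sum, Pi.smul_apply, smul_eq_mul, mul_smul_comm]

theorem abs_units_smul (u : ℤˣ) (x : ℝ) : |u • x| = |x| := by
  obtain rfl | rfl := Int.units_eq_one_or u <;> simp

theorem abs_sum_le_card_mul {x : ι → ℝ} {c : ℝ} (hx : ∀ i, |x i| ≤ c) :
    |∑ i, x i| ≤ Fintype.card ι * c := by
  calc |∑ i, x i| ≤ ∑ i, |x i| := Finset.abs_sum_le_sum_abs _ _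
    _ ≤ ∑ _i : ι, c := Finset.sum_le_sum fun i _ => hx i
    _ = Fintype.card ι * c := by simp

theorem abs_signedSum_le (e : ι → ℤˣ) {x : ι → ℝ} {c : ℝ} (hx : ∀ i, |x i| ≤ c) :
    |signedSum e x| ≤ Fintype.card ι * c :=
  abs_sum_le_card_mul fun i => (abs_units_smul (e i) (x i)).trans_le (hx i)

theorem bddAbove_range_signedSum {T : Type*} {v : T → ι → ℝ} {c : ℝ} (hv : ∀ t i, |v t i| ≤ c)
    (e : ι → ℤˣ) : BddAbove (Set.range fun t => signedSum e (v t)) :=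
  ⟨Fintype.card ι * c, Set.forall_mem_range.2 fun t => (abs_le.1 (abs_signedSum_le e (hv t))).2⟩

variable [DecidableEq ι]

theorem expect_signedSum (x : ι → ℝ) : 𝔼 e, signedSum e x = 0 := by
  have hneg : 𝔼 e, signedSum e x = 𝔼 e, -signedSum e x :=
    Fintype.expect_equiv (Equiv.neg _) _ _ fun e => by simp [signedSum_neg_left]
  rw [Finset.expect_neg_distrib] at hneg
  linarith

theorem expect_exp_signedSum (x : ι → ℝ) :
    𝔼 e, Real.exp (signedSum e x) = ∏ i, Real.cosh (x i) := by
  have hcosh (i : ι) : Real.cosh (x i) = 2⁻¹ * ∑ u : ℤˣ, Real.exp (u • x i) := by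
    simp [Real.cosh_eq, UnitsInt.univ]
    ring
  simp only [hcosh, Finset.prod_mul_distrib, Fintype.expect_eq_sum_div_card, Fintype.prod_sum,
    signedSum, Real.exp_sum]
  simp [div_eq_inv_mul]

theorem expect_exp_signedSum_le (x : ι → ℝ) :
    𝔼 e, Real.exp (signedSum e x) ≤ Real.exp ((∑ i, x i ^ 2) / 2) := by
  rw [expect_exp_signedSum, Finset.sum_div, Real.exp_sum]
  gcongr
  exact Real.cosh_le_exp_half_sq _

theorem exp_expect_le {α : Type*} [Fintype α] [Nonempty α] (f : α → ℝ) :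
    Real.exp (𝔼 a, f a) ≤ 𝔼 a, Real.exp (f a) := by
  have hjensen := convexOn_exp.map_sum_le (t := Finset.univ) (p := f)
    (w := fun _ => (Fintype.card α : ℝ)⁻¹) (by simp) (by simp) (by simp)
  simpa [Fintype.expect_eq_sum_div_card, div_eq_inv_mul, Finset.mul_sum] using hjensen

theorem mul_expect_signedSum_le_of_mem {A : Finset (ι → ℝ)} {X : (ι → ℤˣ) → ι → ℝ}
    (hX : ∀ e, X e ∈ A) {r H : ℝ} (hcard : (A.card : ℝ) ≤ Real.exp H)
    (hA : ∀ x ∈ A, ∑ i, x i ^ 2 ≤ r ^ 2) (c : ℝ) :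
    c * 𝔼 e, signedSum e (X e) ≤ H + (c * r) ^ 2 / 2 := by
  have hmgf (x) (hx : x ∈ A) :
      𝔼 e, Real.exp (signedSum e (c • x)) ≤ Real.exp ((c * r) ^ 2 / 2) := by
    refine (expect_exp_signedSum_le _).trans (Real.exp_le_exp.2 ?_)
    simp only [Pi.smul_apply, smul_eq_mul, mul_pow, ← Finset.mul_sum]
    gcongr
    exact hA x hx
  rw [← Real.exp_le_exp, Real.exp_add]
  calc Real.exp (c * 𝔼 e, signedSum e (X e))
      ≤ 𝔼 e, Real.exp (signedSum e (c • X e)) := by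
        simpa only [signedSum_smul, Finset.mul_expect] using exp_expect_le _
    _ ≤ 𝔼 e, ∑ x ∈ A, Real.exp (signedSum e (c • x)) := Finset.expect_le_expect fun e _ =>
        Finset.single_le_sum (f := fun x => Real.exp (signedSum e (c • x)))
          (fun _ _ => (Real.exp_pos _).le) (hX e)
    _ = ∑ x ∈ A, 𝔼 e, Real.exp (signedSum e (c • x)) := Finset.expect_sum_comm _ _ _
    _ ≤ A.card * Real.exp ((c * r) ^ 2 / 2) := by
        simpa only [nsmul_eq_mul] using Finset.sum_le_card_nsmul _ _ _ hmgf
    _ ≤ Real.exp H * Real.exp ((c * r) ^ 2 / 2) := by gcongr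

theorem expect_signedSum_le_of_mem {A : Finset (ι → ℝ)} {X : (ι → ℤˣ) → ι → ℝ}
    (hX : ∀ e, X e ∈ A) {r H : ℝ} (hr : 0 ≤ r) (hH : 0 < H) (hcard : (A.card : ℝ) ≤ Real.exp H)
    (hA : ∀ x ∈ A, ∑ i, x i ^ 2 ≤ r ^ 2) :
    𝔼 e, signedSum e (X e) ≤ r * √(2 * H) := by
  obtain rfl | hr := hr.eq_or_lt
  · have hzero (e : ι → ℤˣ) : X e = 0 := by
      have hsum : ∑ i, X e i ^ 2 = 0 :=
        le_antisymm (by simpa using hA _ (hX e)) (Finset.sum_nonneg fun _ _ => sq_nonneg _)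
      simpa [Finset.sum_eq_zero_iff_of_nonneg, sq_nonneg, funext_iff] using hsum
    simp [hzero, signedSum]
  · have hsqrt : √(2 * H) ^ 2 = 2 * H := Real.sq_sqrt (by positivity)
    have hsqrt_pos : 0 < √(2 * H) := by positivity
    have hopt := mul_expect_signedSum_le_of_mem hX hcard hA (√(2 * H) / r)
    rw [div_mul_cancel₀ _ hr.ne', hsqrt, div_mul_eq_mul_div, div_le_iff₀ hr] at hopt
    refine le_of_mul_le_mul_left (hopt.trans_eq ?_) hsqrt_pos
    linear_combination -r * hsqrt

/-- The Rademacher complexity `𝔼ₑ sup_t ∑ eᵢ v(t)ᵢ` of a family of vectors. It is not divided by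
the number of coordinates. -/
noncomputable def rademacherComplexity {T : Type*} (v : T → ι → ℝ) : ℝ :=
  𝔼 e, ⨆ t, signedSum e (v t)

theorem rademacherComplexity_le_of_selection {T : Type*} [Nonempty T] {v : T → ι → ℝ} {b : ℝ}
    (hb : ∀ t : (ι → ℤˣ) → T, 𝔼 e, signedSum e (v (t e)) ≤ b) : rademacherComplexity v ≤ b := by
  refine le_of_forall_pos_le_add fun ε hε => ?_
  have hselect (e : ι → ℤˣ) : ∃ t, ⨆ s, signedSum e (v s) ≤ signedSum e (v t) + ε := by
    obtain ⟨t, ht⟩ := exists_lt_of_lt_ciSup (sub_lt_self (⨆ s, signedSum e (v s)) hε)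
    exact ⟨t, by linarith⟩
  choose t ht using hselect
  calc rademacherComplexity v ≤ 𝔼 e, (signedSum e (v (t e)) + ε) :=
        Finset.expect_le_expect fun e _ => ht e
    _ = 𝔼 e, signedSum e (v (t e)) + ε := by
        rw [Finset.expect_add_distrib, Fintype.expect_const]
    _ ≤ b + ε := by gcongr; exact hb t

end RademacherComplexity

section Chaining

variable {ι : Type*}

/-- The representative in the family `v` of the code `c t`, a vector depending on `c t` only. -/
noncomputable def codeCenter {T κ : Type*} [Nonempty T] (v : T → ι → ℝ) (c : T → κ) (k : κ) :
    ι → ℝ :=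
  v (Function.invFun c k)

theorem abs_sub_codeCenter_le {T κ : Type*} [Nonempty T] {v : T → ι → ℝ} {c : T → κ} {δ : ℝ}
    (hc : ∀ s t, c s = c t → ∀ i, |v s i - v t i| ≤ δ) (t : T) (i : ι) :
    |v t i - codeCenter v c (c t) i| ≤ δ :=
  hc _ _ (Function.invFun_eq ⟨t, rfl⟩).symm i

variable [Fintype ι] [DecidableEq ι]

theorem expect_signedSum_sub_le {A A' : Finset (ι → ℝ)} {X Y : (ι → ℤˣ) → ι → ℝ}
    (hX : ∀ e, X e ∈ A) (hY : ∀ e, Y e ∈ A') {δ H : ℝ} (hδ : 0 ≤ δ) (hH : 0 < H)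
    (hcard : (A.card : ℝ) * A'.card ≤ Real.exp H) (hXY : ∀ e i, |X e i - Y e i| ≤ δ) :
    𝔼 e, signedSum e (X e - Y e) ≤ √(Fintype.card ι) * δ * √(2 * H) := by
  classical
  set D : Finset (ι → ℝ) := Finset.univ.image fun e => X e - Y e
  have hD : D ⊆ Finset.image₂ (· - ·) A A' :=
    Finset.image_subset_iff.2 fun e _ => Finset.mem_image₂_of_mem (hX e) (hY e)
  have hDcard : D.card ≤ A.card * A'.card :=
    (Finset.card_le_card hD).trans (Finset.card_image₂_le _ _ _)
  have hmem (e : ι → ℤˣ) : X e - Y e ∈ D := Finset.mem_image_of_mem _ (Finset.mem_univ e)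
  refine expect_signedSum_le_of_mem hmem (by positivity) hH
    (le_trans (by exact_mod_cast hDcard) hcard) (Finset.forall_mem_image.2 fun e _ => ?_)
  calc ∑ i, (X e i - Y e i) ^ 2 ≤ ∑ _i : ι, δ ^ 2 :=
        Finset.sum_le_sum fun i _ => sq_le_sq.2 ((hXY e i).trans (le_abs_self δ))
    _ = (√(Fintype.card ι) * δ) ^ 2 := by simp [mul_pow]

theorem expect_signedSum_eq_sum_links (X : (ι → ℤˣ) → ι → ℝ) (P : ℕ → (ι → ℤˣ) → ι → ℝ)
    (hP : ∀ e e', P 0 e = P 0 e') (J : ℕ) :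
    𝔼 e, signedSum e (X e) = ∑ j ∈ Finset.range J, 𝔼 e, signedSum e (P (j + 1) e - P j e) +
      𝔼 e, signedSum e (X e - P J e) := by
  have hroot : 𝔼 e, signedSum e (P 0 e) = 0 := by
    simpa only [hP _ 1] using expect_signedSum (P 0 1)
  rw [← Finset.expect_sum_comm, ← Finset.expect_add_distrib, ← sub_eq_zero, ← hroot,
    ← Finset.expect_sub_distrib]
  refine Finset.expect_congr rfl fun e _ => ?_
  simp only [signedSum_sub, Finset.sum_range_sub fun j => signedSum e (P j e)]
  ring

theorem natClog_two_le (n : ℕ) : (Nat.clog 2 n : ℝ) ≤ 2 * (1 + Real.log n) := by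
  have hlog : 0 ≤ Real.log n := Real.log_natCast_nonneg n
  have hlog2 : (1 / 2 : ℝ) ≤ Real.log 2 := by linarith [Real.log_two_gt_d9]
  have hlogb : Real.logb 2 n ≤ 2 * Real.log n := by
    rw [Real.logb, div_le_iff₀ (by linarith)]
    nlinarith
  have hlogb_nonneg : 0 ≤ Real.logb 2 n := div_nonneg hlog (by linarith)
  have hceil := Nat.ceil_lt_add_one hlogb_nonneg
  rw [← Real.natCeil_logb_natCast 2 n]
  push_cast
  linarith

variable {T : Type*} [Nonempty T] {v : T → ι → ℝ} {κ : ℕ → Type*} [∀ j, Fintype (κ j)]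
  {c : ∀ j, T → κ j} {K H : ℝ}

theorem expect_signedSum_link_le (hK : 0 ≤ K) (hH : 0 < H)
    (hcard : ∀ j, (Fintype.card (κ j) : ℝ) ≤ Real.exp (4 ^ j * H))
    (hc : ∀ j s t, c j s = c j t → ∀ i, |v s i - v t i| ≤ K * (1 / 2) ^ j)
    (t : (ι → ℤˣ) → T) (j : ℕ) :
    𝔼 e, signedSum e (codeCenter v (c (j + 1)) (c (j + 1) (t e)) - codeCenter v (c j) (c j (t e)))
      ≤ 5 * K * √(Fintype.card ι * H) := by
  classical
  have hmem (j : ℕ) (e : ι → ℤˣ) : codeCenter v (c j) (c j (t e)) ∈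
      Finset.univ.image (codeCenter v (c j)) := Finset.mem_image_of_mem _ (Finset.mem_univ _)
  have himage (j : ℕ) :
      ((Finset.univ.image (codeCenter v (c j))).card : ℝ) ≤ Real.exp (4 ^ j * H) :=
    le_trans (by exact_mod_cast Finset.card_image_le) (hcard j)
  have hlink := expect_signedSum_sub_le (hmem (j + 1)) (hmem j)
    (δ := 3 / 2 * (K * (1 / 2) ^ j)) (H := 5 * (4 ^ j * H)) (by positivity) (by positivity)
    (by
      refine (mul_le_mul (himage _) (himage _) (by positivity) (by positivity)).trans_eq ?_
      rw [← Real.exp_add]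
      ring_nf)
    (fun e i => by
      have hfine := abs_le.1 (abs_sub_codeCenter_le (hc (j + 1)) (t e) i)
      have hcoarse := abs_le.1 (abs_sub_codeCenter_le (hc j) (t e) i)
      rw [pow_succ] at hfine
      exact abs_le.2 ⟨by linarith, by linarith⟩)
  refine hlink.trans ?_
  have hscale : √(2 * (5 * (4 ^ j * H))) = 2 ^ j * √10 * √H := by
    rw [show (2 * (5 * (4 ^ j * H)) : ℝ) = (2 ^ j) ^ 2 * 10 * H by
      rw [← pow_mul, mul_comm j 2, pow_mul]; norm_num; ring, Real.sqrt_mul (by positivity),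
      Real.sqrt_mul (by positivity), Real.sqrt_sq (by positivity)]
  have hsqrt10 : √(10 : ℝ) ≤ 10 / 3 := Real.sqrt_le_iff.2 ⟨by norm_num, by norm_num⟩
  have hcancel : ((1 : ℝ) / 2) ^ j * 2 ^ j = 1 := by rw [← mul_pow]; norm_num
  rw [hscale, Real.sqrt_mul (by positivity)]
  calc √(Fintype.card ι) * (3 / 2 * (K * (1 / 2) ^ j)) * (2 ^ j * √10 * √H)
      = 3 / 2 * K * (√(Fintype.card ι) * √H) * √10 * ((1 / 2) ^ j * 2 ^ j) := by ring
    _ ≤ 3 / 2 * K * (√(Fintype.card ι) * √H) * (10 / 3) * 1 := by rw [hcancel]; gcongr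
    _ = 5 * K * (√(Fintype.card ι) * √H) := by ring

theorem expect_signedSum_residual_le (hK : 0 ≤ K) {J : ℕ} (hJ : Fintype.card ι ≤ 2 ^ J)
    {X P : (ι → ℤˣ) → ι → ℝ} (hXP : ∀ e i, |X e i - P e i| ≤ K * (1 / 2) ^ J) :
    𝔼 e, signedSum e (X e - P e) ≤ K := by
  refine Finset.expect_le Finset.univ_nonempty fun e _ => ?_
  calc signedSum e (X e - P e) ≤ Fintype.card ι * (K * (1 / 2) ^ J) :=
        (le_abs_self _).trans (abs_signedSum_le e (hXP e))
    _ ≤ 2 ^ J * (K * (1 / 2) ^ J) := by gcongr; exact_mod_cast hJ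
    _ = K := by rw [mul_left_comm, ← mul_pow]; norm_num

/-- **Dudley's chaining bound**, with the nets of dyadic scale given as codes: vectors with the
same code at scale `j` are `K / 2 ^ j`-close. -/
theorem rademacherComplexity_le_of_codes [Nonempty ι] [Subsingleton (κ 0)] (hK : 0 ≤ K)
    (hH : Real.log 2 ≤ H) (hcard : ∀ j, (Fintype.card (κ j) : ℝ) ≤ Real.exp (4 ^ j * H))
    (hc : ∀ j s t, c j s = c j t → ∀ i, |v s i - v t i| ≤ K * (1 / 2) ^ j) :
    rademacherComplexity v ≤ 12 * K * √(Fintype.card ι * H) * (1 + Real.log (Fintype.card ι)) := by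
  have hH_ge : (1 / 2 : ℝ) ≤ H := by linarith [Real.log_two_gt_d9]
  have hlog : 0 ≤ Real.log (Fintype.card ι) := Real.log_natCast_nonneg _
  refine rademacherComplexity_le_of_selection fun t => ?_
  set J := Nat.clog 2 (Fintype.card ι)
  set P : ℕ → (ι → ℤˣ) → ι → ℝ := fun j e => codeCenter v (c j) (c j (t e))
  have hlinks : ∑ j ∈ Finset.range J, 𝔼 e, signedSum e (P (j + 1) e - P j e) ≤
      J * (5 * K * √(Fintype.card ι * H)) := by
    simpa using Finset.sum_le_card_nsmul (Finset.range J) _ _ fun j _ =>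
      expect_signedSum_link_le hK (by linarith) hcard hc t j
  have hresidual : 𝔼 e, signedSum e (v (t e) - P J e) ≤ K :=
    expect_signedSum_residual_le hK (Nat.le_pow_clog one_lt_two _)
      fun e => abs_sub_codeCenter_le (hc J) (t e)
  have hsqrt : 1 / 2 ≤ √(Fintype.card ι * H) := by
    have hcard_ge : (1 : ℝ) ≤ Fintype.card ι := by exact_mod_cast Fintype.card_pos
    exact Real.le_sqrt_of_sq_le (by nlinarith)
  have hresidual_le : K ≤ 2 * K * √(Fintype.card ι * H) * (1 + Real.log (Fintype.card ι)) := by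
    have hone : K * 1 ≤ K * (2 * √(Fintype.card ι * H) * (1 + Real.log (Fintype.card ι))) := by
      gcongr
      nlinarith
    linarith
  rw [expect_signedSum_eq_sum_links _ P
    (fun e e' => congrArg (codeCenter v (c 0)) (Subsingleton.elim _ _)) J]
  calc _ ≤ J * (5 * K * √(Fintype.card ι * H)) + K := add_le_add hlinks hresidual
    _ ≤ 2 * (1 + Real.log (Fintype.card ι)) * (5 * K * √(Fintype.card ι * H)) +
        2 * K * √(Fintype.card ι * H) * (1 + Real.log (Fintype.card ι)) := by
      gcongr
      exact natClog_two_le _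
    _ = _ := by ring

end Chaining

section BoundedDifferences

theorem abs_iSup_le {T : Type*} [Nonempty T] {f : T → ℝ} {c : ℝ} (hf : ∀ t, |f t| ≤ c) :
    |⨆ t, f t| ≤ c := by
  have hbdd : BddAbove (Set.range f) := ⟨c, Set.forall_mem_range.2 fun t => (abs_le.1 (hf t)).2⟩
  let t₀ := Classical.arbitrary T
  exact abs_le.2 ⟨(abs_le.1 (hf t₀)).1.trans (le_ciSup hbdd t₀),
    ciSup_le fun t => (abs_le.1 (hf t)).2⟩

theorem iSup_le_iSup_add {T : Type*} [Nonempty T] {f g : T → ℝ} {c : ℝ}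
    (h : ∀ t, |f t - g t| ≤ c) : ⨆ t, f t ≤ (⨆ t, g t) + c := by
  have hfg (t : T) : f t ≤ g t + c := by linarith [(abs_le.1 (h t)).2]
  have hgf (t : T) : g t ≤ f t + c := by linarith [(abs_le.1 (h t)).1]
  by_cases hg : BddAbove (Set.range g)
  · exact ciSup_le fun t => (hfg t).trans (by gcongr; exact le_ciSup hg t)
  · have hf : ¬BddAbove (Set.range f) := fun ⟨b, hb⟩ => hg
      ⟨b + c, Set.forall_mem_range.2 fun t => (hgf t).trans (by gcongr; exact hb ⟨t, rfl⟩)⟩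
    have hc : 0 ≤ c := (abs_nonneg _).trans (h (Classical.arbitrary T))
    simpa [Real.iSup_of_not_bddAbove hf, Real.iSup_of_not_bddAbove hg] using hc

theorem abs_iSup_sub_iSup_le {T : Type*} [Nonempty T] {f g : T → ℝ} {c : ℝ}
    (h : ∀ t, |f t - g t| ≤ c) : |(⨆ t, f t) - ⨆ t, g t| ≤ c := by
  have hfg := iSup_le_iSup_add h
  have hgf := iSup_le_iSup_add (f := g) (g := f) fun t => by rw [abs_sub_comm]; exact h t
  exact abs_le.2 ⟨by linarith, by linarith⟩

variable {ι Ω : Type*} [DecidableEq ι]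

/-- The bounded differences condition: changing the coordinate `i` changes `f` by at most `c i`. -/
def HasBoundedDifferences (f : (ι → Ω) → ℝ) (c : ι → ℝ≥0) : Prop :=
  ∀ S i x, |f (Function.update S i x) - f S| ≤ c i

theorem hasBoundedDifferences_sum [Fintype ι] {φ : ι → Ω → ℝ} {c : ι → ℝ≥0}
    (hφ : ∀ i x y, |φ i x - φ i y| ≤ c i) :
    HasBoundedDifferences (fun S => ∑ i, φ i (S i)) c := by
  intro S k x
  rw [← Finset.sum_sub_distrib, Finset.sum_eq_single_of_mem k (Finset.mem_univ k)
    fun i _ hi => by rw [Function.update_of_ne hi, sub_self]]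
  exact hφ _ _ _

namespace HasBoundedDifferences

theorem sub {f g : (ι → Ω) → ℝ} {c c' : ι → ℝ≥0} (hf : HasBoundedDifferences f c)
    (hg : HasBoundedDifferences g c') :
    HasBoundedDifferences (fun S => f S - g S) (c + c') := by
  intro S i x
  rw [sub_sub_sub_comm]
  exact (abs_sub _ _).trans (add_le_add (hf S i x) (hg S i x))

theorem const_mul {f : (ι → Ω) → ℝ} {c : ι → ℝ≥0} (hf : HasBoundedDifferences f c) (a : ℝ≥0) :
    HasBoundedDifferences (fun S => a * f S) (a • c) := by
  intro S i x
  rw [← mul_sub, abs_mul, NNReal.abs_eq]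
  exact mul_le_mul_of_nonneg_left (hf S i x) a.coe_nonneg

theorem iSup {T : Type*} [Nonempty T] {f : T → (ι → Ω) → ℝ} {c : ι → ℝ≥0}
    (hf : ∀ t, HasBoundedDifferences (f t) c) : HasBoundedDifferences (fun S => ⨆ t, f t S) c :=
  fun S i x => abs_iSup_sub_iSup_le fun t => hf t S i x

theorem expect {α : Type*} [Fintype α] [Nonempty α] {f : α → (ι → Ω) → ℝ} {c : ι → ℝ≥0}
    (hf : ∀ a, HasBoundedDifferences (f a) c) : HasBoundedDifferences (fun S => 𝔼 a, f a S) c := by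
  intro S i x
  rw [← Finset.expect_sub_distrib]
  exact (Finset.abs_expect_le _ _).trans
    (Finset.expect_le Finset.univ_nonempty fun a _ => hf a S i x)

end HasBoundedDifferences

end BoundedDifferences

section McDiarmid

open ProbabilityTheory

theorem abs_integral_le_of_abs_le {Ω : Type*} [MeasurableSpace Ω] {μ : Measure Ω}
    [IsProbabilityMeasure μ] {f : Ω → ℝ} {b : ℝ} (hb : ∀ x, |f x| ≤ b) : |∫ x, f x ∂μ| ≤ b := by
  simpa using norm_integral_le_of_norm_le_const (μ := μ) (f := f) (.of_forall hb)

theorem integrable_exp_mul_of_abs_le {Ω : Type*} [MeasurableSpace Ω] {μ : Measure Ω}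
    [IsFiniteMeasure μ] {f : Ω → ℝ} (hf : Measurable f) {b : ℝ} (hb : ∀ x, |f x| ≤ b) (l : ℝ) :
    Integrable (fun x => Real.exp (l * f x)) μ := by
  refine .of_bound (by fun_prop) (Real.exp (|l| * b)) (.of_forall fun x => ?_)
  rw [Real.norm_eq_abs, Real.abs_exp, Real.exp_le_exp]
  calc l * f x ≤ |l| * |f x| := (le_abs_self _).trans_eq (abs_mul _ _)
    _ ≤ |l| * b := by gcongr; exact hb x

theorem hasSubgaussianMGF_of_abs_sub_le {Ω : Type*} [MeasurableSpace Ω] {μ : Measure Ω}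
    [IsProbabilityMeasure μ] {f : Ω → ℝ} (hf : Measurable f) {c : ℝ≥0}
    (hc : ∀ x y, |f x - f y| ≤ c) :
    HasSubgaussianMGF (fun x => f x - ∫ y, f y ∂μ) ((c / 2) ^ 2) μ := by
  obtain ⟨x₀⟩ : Nonempty Ω := nonempty_of_isProbabilityMeasure μ
  have : Nonempty Ω := ⟨x₀⟩
  have hbdd : BddBelow (Set.range f) :=
    ⟨f x₀ - c, Set.forall_mem_range.2 fun x => by linarith [(abs_le.1 (hc x x₀)).1]⟩
  have hrange (x : Ω) : f x ∈ Set.Icc (⨅ y, f y) ((⨅ y, f y) + c) := by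
    refine ⟨ciInf_le hbdd x, sub_le_iff_le_add.1 (le_ciInf fun y => ?_)⟩
    linarith [(abs_le.1 (hc x y)).2]
  simpa using hasSubgaussianMGF_of_mem_Icc hf.aemeasurable (.of_forall hrange)

theorem hasSubgaussianMGF_prod {α β : Type*} [MeasurableSpace α] [MeasurableSpace β]
    {μ : Measure α} {ν : Measure β} [IsProbabilityMeasure μ] [IsProbabilityMeasure ν]
    {f : α × β → ℝ} (hf : Measurable f) {b : ℝ} (hb : ∀ p, |f p| ≤ b) {c c' : ℝ≥0}
    (hfst : ∀ y, HasSubgaussianMGF (fun x => f (x, y) - ∫ x', f (x', y) ∂μ) c μ)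
    (hsnd : HasSubgaussianMGF
      (fun y => (∫ x, f (x, y) ∂μ) - ∫ y', ∫ x, f (x, y') ∂μ ∂ν) c' ν) :
    HasSubgaussianMGF (fun p => f p - ∫ q, f q ∂μ.prod ν) (c + c') (μ.prod ν) := by
  have hmean : ∫ q, f q ∂μ.prod ν = ∫ y, ∫ x, f (x, y) ∂μ ∂ν :=
    integral_prod_symm f (.of_bound hf.aestronglyMeasurable b (.of_forall hb))
  rw [hmean]
  set m := ∫ y, ∫ x, f (x, y) ∂μ ∂ν
  have hint (l : ℝ) : Integrable (fun p => Real.exp (l * (f p - m))) (μ.prod ν) :=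
    integrable_exp_mul_of_abs_le (hf.sub_const m) (b := b + |m|)
      (fun p => (abs_sub _ _).trans (by gcongr; exact hb p)) l
  refine ⟨hint, fun l => ?_⟩
  have hinner (y : β) : ∫ x, Real.exp (l * (f (x, y) - m)) ∂μ ≤
      Real.exp (c * l ^ 2 / 2) * Real.exp (l * ((∫ x, f (x, y) ∂μ) - m)) := by
    have hsplit (x : α) : Real.exp (l * (f (x, y) - m)) =
        Real.exp (l * (f (x, y) - ∫ x', f (x', y) ∂μ)) *
          Real.exp (l * ((∫ x', f (x', y) ∂μ) - m)) := by
      rw [← Real.exp_add]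
      ring_nf
    simp only [hsplit, integral_mul_const]
    gcongr
    exact (hfst y).mgf_le l
  calc mgf (fun p => f p - m) (μ.prod ν) l
      = ∫ y, ∫ x, Real.exp (l * (f (x, y) - m)) ∂μ ∂ν := integral_prod_symm _ (hint l)
    _ ≤ ∫ y, Real.exp (c * l ^ 2 / 2) * Real.exp (l * ((∫ x, f (x, y) ∂μ) - m)) ∂ν :=
        integral_mono (hint l).integral_prod_right
          ((hsnd.integrable_exp_mul l).const_mul _) hinner
    _ ≤ Real.exp (c * l ^ 2 / 2) * Real.exp (c' * l ^ 2 / 2) := by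
        rw [integral_const_mul]
        gcongr
        exact hsnd.mgf_le l
    _ = Real.exp ((c + c' : ℝ≥0) * l ^ 2 / 2) := by
        rw [← Real.exp_add, NNReal.coe_add]
        ring_nf

variable {Ω : Type*} [MeasurableSpace Ω]

theorem measurable_finCons {n : ℕ} :
    Measurable fun p : Ω × (Fin n → Ω) => (Fin.cons p.1 p.2 : Fin (n + 1) → Ω) :=
  measurable_pi_iff.2 (Fin.cases measurable_fst fun i => by
    simpa only [Fin.cons_succ] using measurable_snd.eval)

theorem measurePreserving_finCons {n : ℕ} (μ : Fin (n + 1) → Measure Ω) [∀ i, SigmaFinite (μ i)] :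
    MeasurePreserving (fun p : Ω × (Fin n → Ω) => (Fin.cons p.1 p.2 : Fin (n + 1) → Ω))
      ((μ 0).prod (.pi fun i => μ i.succ)) (.pi μ) := by
  convert (measurePreserving_piFinSuccAbove μ 0).symm using 2
  · simp [MeasurableEquiv.piFinSuccAbove_symm_apply, Fin.insertNthEquiv]
  · simp only [Fin.succAbove_zero]

theorem HasBoundedDifferences.integral_finCons {n : ℕ} {f : (Fin (n + 1) → Ω) → ℝ}
    {c : Fin (n + 1) → ℝ≥0} (hc : HasBoundedDifferences f c) (hf : Measurable f) {b : ℝ}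
    (hb : ∀ S, |f S| ≤ b) (μ : Measure Ω) [IsProbabilityMeasure μ] :
    HasBoundedDifferences (fun S => ∫ x, f (Fin.cons x S) ∂μ) fun i => c i.succ := by
  intro S i y
  have hint (S : Fin n → Ω) : Integrable (fun x => f (Fin.cons x S)) μ :=
    .of_bound (hf.comp (measurable_finCons.comp measurable_prodMk_right)).aestronglyMeasurable b
      (.of_forall fun _ => hb _)
  rw [← integral_sub (hint _) (hint _)]
  refine abs_integral_le_of_abs_le fun x => ?_
  rw [Fin.cons_update]
  exact hc _ _ _

theorem HasBoundedDifferences.hasSubgaussianMGF {n : ℕ} {f : (Fin n → Ω) → ℝ} {c : Fin n → ℝ≥0}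
    (hc : HasBoundedDifferences f c) (hf : Measurable f) {b : ℝ} (hb : ∀ S, |f S| ≤ b)
    (μ : Fin n → Measure Ω) [∀ i, IsProbabilityMeasure (μ i)] :
    HasSubgaussianMGF (fun S => f S - ∫ S', f S' ∂Measure.pi μ) (∑ i, (c i / 2) ^ 2)
      (Measure.pi μ) := by
  induction n with
  | zero =>
    have hconst : (fun S => f S - ∫ S', f S' ∂Measure.pi μ) = fun _ => 0 := by
      funext S
      simp only [Subsingleton.elim _ S, integral_const, probReal_univ, one_smul, sub_self]
    rw [hconst, Fin.sum_univ_zero]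
    exact .fun_zero
  | succ n ih =>
    set tail := Measure.pi fun i : Fin n => μ i.succ
    have hcons := measurePreserving_finCons μ
    have hfcons := hf.comp (measurable_finCons (Ω := Ω) (n := n))
    have hhead (S : Fin n → Ω) : HasSubgaussianMGF
        (fun x => f (Fin.cons x S) - ∫ x', f (Fin.cons x' S) ∂μ 0) ((c 0 / 2) ^ 2) (μ 0) := by
      refine hasSubgaussianMGF_of_abs_sub_le (hfcons.comp measurable_prodMk_right) fun x y => ?_
      simpa using hc (Fin.cons y S) 0 x
    have htail := ih (hc.integral_finCons hf hb (μ 0))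
      (hfcons.stronglyMeasurable.integral_prod_left' (μ := μ 0)).measurable
      (fun S => abs_integral_le_of_abs_le fun x => hb _) fun i => μ i.succ
    have hprod := hasSubgaussianMGF_prod hfcons (fun p => hb _) hhead htail
    have hmean : ∫ p, f (Fin.cons p.1 p.2) ∂(μ 0).prod tail = ∫ S, f S ∂Measure.pi μ := by
      rw [← hcons.map_eq, integral_map hcons.measurable.aemeasurable hf.aestronglyMeasurable]
    rw [Fin.sum_univ_succ]
    refine (hmean ▸ hprod).congr_identDistrib
      ⟨(hfcons.sub_const _).aemeasurable, (hf.sub_const _).aemeasurable, ?_⟩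
    rw [← hcons.map_eq, Measure.map_map (hf.sub_const _) hcons.measurable]
    rfl

end McDiarmid

section Symmetrization

variable {ι Ω T : Type*} [Fintype ι]

theorem abs_iSup_signedSum_le [Nonempty T] {v : T → ι → ℝ} {c : ℝ} (hv : ∀ t i, |v t i| ≤ c)
    (e : ι → ℤˣ) : |⨆ t, signedSum e (v t)| ≤ Fintype.card ι * c :=
  abs_iSup_le fun t => abs_signedSum_le e (hv t)

theorem abs_rademacherComplexity_le [DecidableEq ι] [Nonempty T] {v : T → ι → ℝ} {c : ℝ}
    (hv : ∀ t i, |v t i| ≤ c) : |rademacherComplexity v| ≤ Fintype.card ι * c :=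
  (Finset.abs_expect_le _ _).trans
    (Finset.expect_le Finset.univ_nonempty fun e _ => abs_iSup_signedSum_le hv e)

theorem hasBoundedDifferences_rademacherComplexity [DecidableEq ι] [Nonempty T]
    {g : T → Ω → ℝ} {c : ℝ≥0} (hg : ∀ t x y, |g t x - g t y| ≤ c) :
    HasBoundedDifferences (fun S : ι → Ω => rademacherComplexity fun t i => g t (S i))
      fun _ => c :=
  .expect fun e => .iSup fun t => hasBoundedDifferences_sum (φ := fun i x => e i • g t x)
    fun i x y => by rw [← smul_sub, abs_units_smul]; exact hg t x y

/-- Exchanges the two samples of a pair at the coordinates with negative sign. -/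
def swapSamples (e : ι → ℤˣ) (p : (ι → Ω) × (ι → Ω)) : (ι → Ω) × (ι → Ω) :=
  (fun i => if e i = 1 then p.1 i else p.2 i, fun i => if e i = 1 then p.2 i else p.1 i)

theorem sum_sub_swapSamples (e : ι → ℤˣ) (p : (ι → Ω) × (ι → Ω)) (f : Ω → ℝ) :
    ∑ i, (f ((swapSamples e p).2 i) - f ((swapSamples e p).1 i)) =
      signedSum e (fun i => f (p.2 i)) + signedSum (-e) fun i => f (p.1 i) := by
  rw [signedSum_neg_left, ← sub_eq_add_neg, ← signedSum_sub]
  refine Finset.sum_congr rfl fun i _ => ?_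
  rcases Int.units_eq_one_or (e i) with h | h <;> simp [swapSamples, h]

variable [MeasurableSpace Ω]

/-- The largest deviation, over a class of functions `g t`, of the empirical sum from its
expectation. -/
noncomputable def supDeviation (D : Measure Ω) (g : T → Ω → ℝ) (S : ι → Ω) : ℝ :=
  ⨆ t, ∑ i, ((∫ x, g t x ∂D) - g t (S i))

theorem hasBoundedDifferences_supDeviation [DecidableEq ι] [Nonempty T] (D : Measure Ω)
    {g : T → Ω → ℝ} {c : ℝ≥0} (hg : ∀ t x y, |g t x - g t y| ≤ c) :
    HasBoundedDifferences (supDeviation (ι := ι) D g) fun _ => c :=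
  .iSup fun t => hasBoundedDifferences_sum (φ := fun _ x => (∫ x', g t x' ∂D) - g t x)
    fun _ x y => by rw [sub_sub_sub_cancel_left, abs_sub_comm]; exact hg t x y

theorem abs_sum_integral_sub_le {D : Measure Ω} [IsProbabilityMeasure D] {f : Ω → ℝ} {c : ℝ}
    (hf : ∀ x, |f x| ≤ c) (S : ι → Ω) :
    |∑ i, ((∫ x, f x ∂D) - f (S i))| ≤ Fintype.card ι * (c + c) :=
  abs_sum_le_card_mul fun _ =>
    (abs_sub _ _).trans (add_le_add (abs_integral_le_of_abs_le hf) (hf _))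

theorem abs_supDeviation_le [Nonempty T] {D : Measure Ω} [IsProbabilityMeasure D]
    {g : T → Ω → ℝ} {c : ℝ} (hg : ∀ t x, |g t x| ≤ c) (S : ι → Ω) :
    |supDeviation D g S| ≤ Fintype.card ι * (c + c) :=
  abs_iSup_le fun t => abs_sum_integral_sub_le (hg t) S

theorem sum_integral_sub_le_supDeviation {D : Measure Ω} [IsProbabilityMeasure D]
    {g : T → Ω → ℝ} {c : ℝ} (hg : ∀ t x, |g t x| ≤ c) (S : ι → Ω) (t : T) :
    ∑ i, ((∫ x, g t x ∂D) - g t (S i)) ≤ supDeviation D g S :=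
  le_ciSup (f := fun t => ∑ i, ((∫ x, g t x ∂D) - g t (S i))) ⟨_, Set.forall_mem_range.2
    fun t => (abs_le.1 (abs_sum_integral_sub_le (hg t) S)).2⟩ t

section Measurability

variable [Countable T] {g : T → Ω → ℝ}

theorem measurable_supDeviation (D : Measure Ω) (hg : ∀ t, Measurable (g t)) :
    Measurable (supDeviation (ι := ι) D g) :=
  .iSup fun t => Finset.measurable_sum _ fun i _ =>
    ((hg t).comp (measurable_pi_apply i)).const_sub _

theorem measurable_iSup_signedSum (hg : ∀ t, Measurable (g t)) (e : ι → ℤˣ) :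
    Measurable fun S : ι → Ω => ⨆ t, signedSum e fun i => g t (S i) :=
  .iSup fun t => Finset.measurable_sum _ fun i _ =>
    ((hg t).comp (measurable_pi_apply i)).const_smul _

theorem measurable_rademacherComplexity [DecidableEq ι] (hg : ∀ t, Measurable (g t)) :
    Measurable fun S : ι → Ω => rademacherComplexity fun t i => g t (S i) := by
  simp only [rademacherComplexity, Finset.expect_eq_sum_div_card]
  exact (Finset.measurable_sum _ fun e _ => measurable_iSup_signedSum hg e).div_const _

end Measurability

theorem integrable_of_abs_le {Ω : Type*} [MeasurableSpace Ω] {μ : Measure Ω} [IsFiniteMeasure μ]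
    {f : Ω → ℝ} (hf : Measurable f) {b : ℝ} (hb : ∀ x, |f x| ≤ b) : Integrable f μ :=
  .of_bound hf.aestronglyMeasurable b (.of_forall hb)

theorem iSup_integral_le_integral_iSup {Ω : Type*} [MeasurableSpace Ω] {μ : Measure Ω}
    [IsFiniteMeasure μ] [Countable T] [Nonempty T] {f : T → Ω → ℝ} (hf : ∀ t, Measurable (f t))
    {b : ℝ} (hb : ∀ t x, |f t x| ≤ b) :
    ⨆ t, ∫ x, f t x ∂μ ≤ ∫ x, ⨆ t, f t x ∂μ :=
  ciSup_le fun t => integral_mono (integrable_of_abs_le (hf t) (hb t))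
    (integrable_of_abs_le (.iSup hf) fun x => abs_iSup_le fun t => hb t x) fun x =>
      le_ciSup (f := fun t => f t x)
        ⟨b, Set.forall_mem_range.2 fun t => (abs_le.1 (hb t x)).2⟩ t

theorem integral_comp_eval (D : ι → Measure Ω) [∀ i, IsProbabilityMeasure (D i)] {f : Ω → ℝ}
    (i : ι) (hf : AEStronglyMeasurable f (D i)) :
    ∫ S : ι → Ω, f (S i) ∂Measure.pi D = ∫ x, f x ∂D i := by
  have heval := measurePreserving_eval D i
  rw [← heval.map_eq] at hf ⊢
  rw [integral_map heval.measurable.aemeasurable hf]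

theorem measurePreserving_swapSamples (D : ι → Measure Ω) [∀ i, SigmaFinite (D i)] (e : ι → ℤˣ) :
    MeasurePreserving (swapSamples e) ((Measure.pi D).prod (.pi D))
      ((Measure.pi D).prod (.pi D)) := by
  have hswap (i : ι) : MeasurePreserving
      (fun q : Ω × Ω => if e i = 1 then q else q.swap) ((D i).prod (D i)) ((D i).prod (D i)) := by
    split_ifs
    exacts [.id _, Measure.measurePreserving_swap]
  have hpairs := measurePreserving_arrowProdEquivProdArrow Ω Ω ι D D
  convert (hpairs.comp (measurePreserving_pi _ _ hswap)).comp hpairs.symm using 1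
  funext p
  refine Prod.ext ?_ ?_ <;> funext i <;>
    simp only [swapSamples, Function.comp_apply, MeasurableEquiv.arrowProdEquivProdArrow,
      Equiv.arrowProdEquivProdArrow, MeasurableEquiv.coe_mk, MeasurableEquiv.symm_mk,
      Equiv.coe_fn_mk, Equiv.coe_fn_symm_mk] <;>
    split_ifs <;> rfl

variable {D : Measure Ω} [IsProbabilityMeasure D] [Countable T] [Nonempty T] {g : T → Ω → ℝ}
  {c : ℝ} (hgm : ∀ t, Measurable (g t)) (hg : ∀ t x, |g t x| ≤ c)

include hgm hg

theorem integrable_iSup_sum_sub :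
    Integrable (fun p : (ι → Ω) × (ι → Ω) => ⨆ t, ∑ i, (g t (p.2 i) - g t (p.1 i)))
      ((Measure.pi fun _ => D).prod (.pi fun _ => D)) := by
  refine integrable_of_abs_le (b := Fintype.card ι * (c + c)) (.iSup fun t => ?_)
    fun p => abs_iSup_le fun t => ?_
  · exact Finset.measurable_sum _ fun i _ => ((hgm t).comp measurable_snd.eval).sub
      ((hgm t).comp measurable_fst.eval)
  · exact abs_sum_le_card_mul fun i => (abs_sub _ _).trans (add_le_add (hg t _) (hg t _))

/-- The ghost sample `p.2` replaces the expectation. -/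
theorem integral_supDeviation_le_integral_iSup_sum_sub :
    ∫ S : ι → Ω, supDeviation D g S ∂Measure.pi (fun _ => D) ≤
      ∫ p : (ι → Ω) × (ι → Ω), ⨆ t, ∑ i, (g t (p.2 i) - g t (p.1 i))
        ∂(Measure.pi fun _ => D).prod (.pi fun _ => D) := by
  rw [integral_prod _ (integrable_iSup_sum_sub hgm hg)]
  refine integral_mono (integrable_of_abs_le (measurable_supDeviation D hgm)
    (abs_supDeviation_le hg)) (integrable_iSup_sum_sub hgm hg).integral_prod_left fun S => ?_
  have hmeas (t : T) (i : ι) : Measurable fun S' : ι → Ω => g t (S' i) - g t (S i) :=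
    ((hgm t).comp (measurable_pi_apply i)).sub_const _
  have hbound (t : T) (i : ι) (S' : ι → Ω) : |g t (S' i) - g t (S i)| ≤ c + c :=
    (abs_sub _ _).trans (add_le_add (hg t _) (hg t _))
  have hmean (t : T) : ∑ i, ((∫ x, g t x ∂D) - g t (S i)) =
      ∫ S' : ι → Ω, ∑ i, (g t (S' i) - g t (S i)) ∂Measure.pi fun _ => D := by
    rw [integral_finsetSum _ fun i _ => integrable_of_abs_le (hmeas t i) (hbound t i)]
    refine Finset.sum_congr rfl fun i _ => ?_
    have hint : Integrable (fun S' : ι → Ω => g t (S' i)) (Measure.pi fun _ => D) :=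
      integrable_of_abs_le ((hgm t).comp (measurable_pi_apply i)) fun _ => hg t _
    rw [integral_sub hint (integrable_const _), integral_comp_eval _ i (hgm t).aestronglyMeasurable]
    simp
  simp only [supDeviation, hmean]
  exact iSup_integral_le_integral_iSup (fun t => Finset.measurable_sum _ fun i _ => hmeas t i)
    fun t S' => abs_sum_le_card_mul fun i => hbound t i S'

theorem integrable_iSup_signedSum (e : ι → ℤˣ) :
    Integrable (fun S : ι → Ω => ⨆ t, signedSum e fun i => g t (S i)) (Measure.pi fun _ => D) :=
  integrable_of_abs_le (measurable_iSup_signedSum hgm e) fun S =>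
    abs_iSup_signedSum_le (fun t i => hg t (S i)) e

theorem integral_iSup_sum_sub_le (e : ι → ℤˣ) :
    ∫ p : (ι → Ω) × (ι → Ω), ⨆ t, ∑ i, (g t (p.2 i) - g t (p.1 i))
        ∂(Measure.pi fun _ => D).prod (.pi fun _ => D) ≤
      (∫ S : ι → Ω, ⨆ t, signedSum e (fun i => g t (S i)) ∂Measure.pi fun _ => D) +
        ∫ S : ι → Ω, ⨆ t, signedSum (-e) (fun i => g t (S i)) ∂Measure.pi fun _ => D := by
  set P : Measure (ι → Ω) := Measure.pi fun _ => D
  have hswap := measurePreserving_swapSamples (fun _ : ι => D) e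
  have hint := integrable_iSup_sum_sub (ι := ι) (D := D) hgm hg
  have hfst := integrable_iSup_signedSum (D := D) hgm hg (-e) |>.comp_fst P
  have hsnd := integrable_iSup_signedSum (D := D) hgm hg e |>.comp_snd P
  have hbdd (e : ι → ℤˣ) (S : ι → Ω) :
      BddAbove (Set.range fun t => signedSum e fun i => g t (S i)) :=
    bddAbove_range_signedSum (fun t i => hg t (S i)) e
  calc ∫ p, ⨆ t, ∑ i, (g t (p.2 i) - g t (p.1 i)) ∂P.prod P
      = ∫ p, ⨆ t, (signedSum e (fun i => g t (p.2 i)) + signedSum (-e) fun i => g t (p.1 i))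
          ∂P.prod P := by
        simp only [← sum_sub_swapSamples]
        conv_lhs => rw [← hswap.map_eq]
        rw [integral_map hswap.measurable.aemeasurable]
        rw [hswap.map_eq]
        exact hint.aestronglyMeasurable
    _ ≤ ∫ p, ((⨆ t, signedSum e fun i => g t (p.2 i)) + ⨆ t, signedSum (-e) fun i => g t (p.1 i))
          ∂P.prod P := by
        refine integral_mono ?_ (hsnd.add hfst) fun p => ?_
        · simpa only [← sum_sub_swapSamples] using! hswap.integrable_comp_of_integrable hint
        · exact ciSup_le fun t => add_le_add (le_ciSup (hbdd e p.2) t) (le_ciSup (hbdd (-e) p.1) t)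
    _ = _ := by
        rw [integral_add hsnd hfst,
          integral_fun_snd (fun S : ι → Ω => ⨆ t, signedSum e fun i => g t (S i)),
          integral_fun_fst (fun S : ι → Ω => ⨆ t, signedSum (-e) fun i => g t (S i)),
          probReal_univ, one_smul, one_smul]

theorem integral_supDeviation_le [DecidableEq ι] :
    ∫ S : ι → Ω, supDeviation D g S ∂(Measure.pi fun _ => D) ≤
      2 * ∫ S : ι → Ω, rademacherComplexity (fun t i => g t (S i)) ∂Measure.pi fun _ => D := by
  set A : (ι → ℤˣ) → ℝ := fun e =>
    ∫ S : ι → Ω, ⨆ t, signedSum e (fun i => g t (S i)) ∂Measure.pi fun _ => D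
  calc ∫ S : ι → Ω, supDeviation D g S ∂(Measure.pi fun _ => D)
      ≤ 𝔼 e, (A e + A (-e)) := Finset.le_expect Finset.univ_nonempty fun e _ =>
        (integral_supDeviation_le_integral_iSup_sum_sub hgm hg).trans
          (integral_iSup_sum_sub_le hgm hg e)
    _ = 2 * 𝔼 e, A e := by
        rw [Finset.expect_add_distrib, Fintype.expect_equiv (Equiv.neg _) (fun e => A (-e)) A
          fun e => rfl, two_mul]
    _ = _ := by
        simp only [rademacherComplexity, Finset.expect_eq_sum_div_card]
        rw [integral_div, integral_finsetSum _ fun e _ => integrable_iSup_signedSum hgm hg e]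

end Symmetrization

section UniformDeviation

theorem HasBoundedDifferences.exists_event_le {Ω : Type*} [MeasurableSpace Ω] {n : ℕ}
    (hn : 0 < n) {f : (Fin n → Ω) → ℝ} {c : ℝ≥0} (hc0 : 0 < c)
    (hc : HasBoundedDifferences f fun _ => c) (hf : Measurable f) {b : ℝ} (hb : ∀ S, |f S| ≤ b)
    (D : Measure Ω) [IsProbabilityMeasure D] {δ : ℝ} (hδ0 : 0 < δ) (hδ1 : δ < 1) :
    ∃ E : Set (Fin n → Ω), MeasurableSet E ∧ 1 - δ ≤ (Measure.pi fun _ => D).real E ∧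
      ∀ S ∈ E, f S ≤ (∫ S', f S' ∂Measure.pi fun _ => D) + c * √(n * Real.log (1 / δ) / 2) := by
  set P : Measure (Fin n → Ω) := Measure.pi fun _ => D
  set ε := c * √(n * Real.log (1 / δ) / 2)
  set E := {S | ε ≤ f S - ∫ S', f S' ∂P}
  have hE : MeasurableSet E := measurableSet_le measurable_const (hf.sub_const _)
  have hlog : 0 < Real.log (1 / δ) := Real.log_pos ((one_lt_div hδ0).2 hδ1)
  have htail : P.real E ≤ δ := by
    refine ((hc.hasSubgaussianMGF hf hb _).measure_ge_le (by positivity)).trans_eq ?_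
    have hvar : ε ^ 2 = c ^ 2 * (n * Real.log (1 / δ) / 2) := by
      rw [mul_pow, Real.sq_sqrt (by positivity)]
    have hexponent : -ε ^ 2 / (2 * ((∑ _i : Fin n, (c / 2) ^ 2 : ℝ≥0) : ℝ)) = Real.log δ := by
      have hc0' : (c : ℝ) ≠ 0 := by exact_mod_cast hc0.ne'
      simp only [hvar, Finset.sum_const, Finset.card_univ, Fintype.card_fin, nsmul_eq_mul, one_div,
        Real.log_inv, NNReal.coe_mul, NNReal.coe_natCast, NNReal.coe_pow, NNReal.coe_div,
        NNReal.coe_ofNat]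
      field_simp
    rw [hexponent, Real.exp_log hδ0]
  refine ⟨Eᶜ, hE.compl, ?_, fun S hS => ?_⟩
  · rw [probReal_compl_eq_one_sub hE]
    linarith
  · linarith [not_le.1 (Set.notMem_ofPred_iff.1 hS)]

theorem hasBoundedDifferences_supDeviation_sub_rademacherComplexity {Ω ι T : Type*}
    [MeasurableSpace Ω] [Fintype ι] [DecidableEq ι] [Nonempty T] (D : Measure Ω) {g : T → Ω → ℝ}
    {c : ℝ≥0} (hg : ∀ t x y, |g t x - g t y| ≤ c) :
    HasBoundedDifferences (fun S : ι → Ω => supDeviation D g S -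
      2 * rademacherComplexity fun t i => g t (S i)) fun _ => 3 * c := by
  have hconst : (fun _ : ι => 3 * c) = (fun _ => c) + (2 : ℝ≥0) • fun _ => c := by
    funext i
    change 3 * c = c + 2 * c
    ring
  rw [hconst]
  exact (hasBoundedDifferences_supDeviation D hg).sub
    ((hasBoundedDifferences_rademacherComplexity hg).const_mul 2)

variable {Ω T : Type*} [MeasurableSpace Ω] [Countable T] [Nonempty T] {g : T → Ω → ℝ}
  (D : Measure Ω) [IsProbabilityMeasure D] {n : ℕ} (hn : 0 < n) {δ : ℝ} (hδ0 : 0 < δ) (hδ1 : δ < 1)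

include hn hδ0 hδ1

theorem exists_event_integral_sub_le (hgm : ∀ t, Measurable (g t))
    (hg : ∀ t x, g t x ∈ Set.Icc (0 : ℝ) 1) :
    ∃ E : Set (Fin n → Ω), MeasurableSet E ∧ 1 - δ ≤ (Measure.pi fun _ => D).real E ∧
      ∀ S ∈ E, ∀ t, (∫ x, g t x ∂D) - (1 / (n : ℝ)) * ∑ i, g t (S i) ≤
        2 / n * rademacherComplexity (fun t i => g t (S i)) +
          3 * √(Real.log (1 / δ) / (2 * n)) := by
  set rad : (Fin n → Ω) → ℝ := fun S => rademacherComplexity fun t i => g t (S i)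
  have habs (t : T) (x : Ω) : |g t x| ≤ 1 := abs_le.2 ⟨by linarith [(hg t x).1], (hg t x).2⟩
  have hdevm : Measurable (supDeviation (ι := Fin n) D g) := measurable_supDeviation D hgm
  have hradm : Measurable rad := measurable_rademacherComplexity hgm
  have hdevb (S : Fin n → Ω) := abs_supDeviation_le (D := D) habs S
  have hradb (S : Fin n → Ω) := abs_rademacherComplexity_le fun t i => habs t (S i)
  have hmean : ∫ S, (supDeviation D g S - 2 * rad S) ∂Measure.pi (fun _ => D) ≤ 0 := by
    rw [integral_sub (integrable_of_abs_le hdevm hdevb)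
      ((integrable_of_abs_le hradm hradb).const_mul _), integral_const_mul]
    exact sub_nonpos.2 (integral_supDeviation_le hgm habs)
  obtain ⟨E, hEm, hE, hdev⟩ :=
    (hasBoundedDifferences_supDeviation_sub_rademacherComplexity D (c := 1) fun t x y =>
      Real.dist_le_of_mem_Icc_01 (hg t x) (hg t y)).exists_event_le hn (by norm_num)
    (hdevm.sub (hradm.const_mul _)) (fun S => (abs_sub _ _).trans (add_le_add (hdevb S)
      ((abs_mul _ _).trans_le (mul_le_mul_of_nonneg_left (hradb S) (abs_nonneg _))))) D hδ0 hδ1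
  refine ⟨E, hEm, hE, fun S hS t => ?_⟩
  have hn' : (0 : ℝ) < n := by exact_mod_cast hn
  have hsqrt : √(n * Real.log (1 / δ) / 2) = n * √(Real.log (1 / δ) / (2 * n)) := by
    rw [show n * Real.log (1 / δ) / 2 = (n : ℝ) ^ 2 * (Real.log (1 / δ) / (2 * n)) by field_simp,
      Real.sqrt_mul (by positivity), Real.sqrt_sq hn'.le]
  have hsum : n * (∫ x, g t x ∂D) - ∑ i, g t (S i) ≤
      2 * rad S + 3 * (n * √(Real.log (1 / δ) / (2 * n))) := by
    have hdevS := hdev S hS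
    have hle := sum_integral_sub_le_supDeviation (D := D) habs S t
    rw [hsqrt] at hdevS
    simp only [Finset.sum_sub_distrib, Finset.sum_const, Finset.card_univ, Fintype.card_fin,
      nsmul_eq_mul] at hle
    push_cast at hdevS
    linarith
  calc (∫ x, g t x ∂D) - (1 / (n : ℝ)) * ∑ i, g t (S i)
      = (n * (∫ x, g t x ∂D) - ∑ i, g t (S i)) / n := by field_simp
    _ ≤ (2 * rad S + 3 * (n * √(Real.log (1 / δ) / (2 * n)))) / n := by gcongr
    _ = 2 / n * rad S + 3 * √(Real.log (1 / δ) / (2 * n)) := by field_simp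

theorem exists_event_integral_sub_le_of_aemeasurable (hgm : ∀ t, AEMeasurable (g t) D)
    (hg : ∀ t x, g t x ∈ Set.Icc (0 : ℝ) 1) :
    ∃ E : Set (Fin n → Ω), MeasurableSet E ∧ 1 - δ ≤ (Measure.pi fun _ => D).real E ∧
      ∀ S ∈ E, ∀ t, (∫ x, g t x ∂D) - (1 / (n : ℝ)) * ∑ i, g t (S i) ≤
        2 / n * rademacherComplexity (fun t i => g t (S i)) +
          3 * √(Real.log (1 / δ) / (2 * n)) := by
  choose g' hg'm hg' hgg' using fun t => (hgm t).exists_ae_eq_range_subset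
    (.of_forall (hg t)) ⟨0, Set.left_mem_Icc.2 zero_le_one⟩
  obtain ⟨E, hEm, hE, hdev⟩ := exists_event_integral_sub_le D hn hδ0 hδ1 hg'm
    fun t x => hg' t (Set.mem_range_self x)
  have hsample : ∀ᵐ S ∂Measure.pi fun _ : Fin n => D, ∀ t i, g t (S i) = g' t (S i) :=
    ae_all_iff.2 fun t => ae_all_iff.2 fun i =>
      (measurePreserving_eval (fun _ : Fin n => D) i).quasiMeasurePreserving.ae (hgg' t)
  obtain ⟨E', hE', hE'm, hagree⟩ := hsample.exists_measurable_mem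
  refine ⟨E ∩ E', hEm.inter hE'm, ?_, fun S hS t => ?_⟩
  · rwa [measureReal_congr (inter_ae_eq_left_of_ae_eq_univ (Filter.eventuallyEq_univ.2 hE'))]
  · rw [integral_congr_ae (hgg' t)]
    simpa only [hagree S hS.2] using hdev S hS.1 t

end UniformDeviation

section Maurey

open scoped RealInnerProductSpace

variable {E : Type*} [NormedAddCommGroup E] [InnerProductSpace ℝ E] {s : Set E} {R : ℝ}

theorem exists_inner_le_of_mem_convexHull {w : E} (hw : w ∈ convexHull ℝ s) (e : E) :
    ∃ x ∈ s, ⟪e, w⟫ ≤ ⟪e, x⟫ :=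
  (((innerₛₗ ℝ e).convexOn (convex_convexHull ℝ s)).exists_ge_of_mem_convexHull
    (subset_convexHull ℝ s) hw)

theorem norm_le_of_mem_convexHull (hs : ∀ x ∈ s, ‖x‖ ≤ R) {w : E} (hw : w ∈ convexHull ℝ s) :
    ‖w‖ ≤ R :=
  mem_closedBall_zero_iff.1 <|
    convexHull_min (fun x hx => mem_closedBall_zero_iff.2 (hs x hx)) (convex_closedBall 0 R) hw

theorem exists_norm_add_sub_sq_le (hs : ∀ x ∈ s, ‖x‖ ≤ R) {w : E} (hw : w ∈ convexHull ℝ s)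
    (e : E) : ∃ x ∈ s, ‖e + (w - x)‖ ^ 2 ≤ ‖e‖ ^ 2 + R ^ 2 := by
  obtain ⟨x, hx, hinner⟩ := exists_inner_le_of_mem_convexHull hw (e + w)
  refine ⟨x, hx, ?_⟩
  have hxR : ‖x‖ ^ 2 ≤ R ^ 2 := pow_le_pow_left₀ (norm_nonneg x) (hs x hx) 2
  rw [← add_sub_assoc, norm_sub_sq_real, norm_add_sq_real]
  rw [inner_add_left, real_inner_self_eq_norm_sq] at hinner
  nlinarith [sq_nonneg ‖w‖]

theorem exists_norm_smul_sub_sum_sq_le (hs : ∀ x ∈ s, ‖x‖ ≤ R) {w : E} (hw : w ∈ convexHull ℝ s)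
    (k : ℕ) : ∃ τ : Fin k → s, ‖(k : ℝ) • w - ∑ t, (τ t : E)‖ ^ 2 ≤ k * R ^ 2 := by
  induction k with
  | zero => exact ⟨Fin.elim0, by simp⟩
  | succ k ih =>
    obtain ⟨τ, hτ⟩ := ih
    obtain ⟨x, hx, hle⟩ := exists_norm_add_sub_sq_le hs hw ((k : ℝ) • w - ∑ t, (τ t : E))
    refine ⟨Fin.cons ⟨x, hx⟩ τ, ?_⟩
    have hsplit : ((k + 1 : ℕ) : ℝ) • w - ∑ t, ((Fin.cons ⟨x, hx⟩ τ : Fin (k + 1) → s) t : E)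
        = (k : ℝ) • w - ∑ t, (τ t : E) + (w - x) := by
      simp only [Fin.sum_univ_succ, Fin.cons_zero, Fin.cons_succ, Nat.cast_succ, add_smul,
        one_smul]
      abel
    rw [hsplit]
    push_cast
    linarith

theorem mul_norm_sub_sq_le {w w' z : E} {k : ℕ} (hw : ‖(k : ℝ) • w - z‖ ^ 2 ≤ k * R ^ 2)
    (hw' : ‖(k : ℝ) • w' - z‖ ^ 2 ≤ k * R ^ 2) : k * ‖w - w'‖ ^ 2 ≤ 4 * R ^ 2 := by
  rcases k.eq_zero_or_pos with rfl | hk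
  · simpa using sq_nonneg R
  have hk' : (0 : ℝ) < k := by exact_mod_cast hk
  have hpar := parallelogram_law_with_norm ℝ ((k : ℝ) • w - z) ((k : ℝ) • w' - z)
  rw [sub_sub_sub_cancel_right, ← smul_sub, norm_smul, Real.norm_of_nonneg hk'.le] at hpar
  refine le_of_mul_le_mul_left ?_ hk'
  nlinarith [mul_self_nonneg ‖(k : ℝ) • w - z + ((k : ℝ) • w' - z)‖]

theorem exists_code_norm_sub_sq_le {κ : Type*} [Nonempty κ] {x : κ → E} (hx : ∀ i, ‖x i‖ ≤ R)
    (k : ℕ) : ∃ c : E → Fin k → κ, ∀ w ∈ convexHull ℝ (Set.range x),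
      ∀ w' ∈ convexHull ℝ (Set.range x), c w = c w' → (k + 1) * ‖w - w'‖ ^ 2 ≤ 8 * R ^ 2 := by
  have hs : ∀ y ∈ Set.range x, ‖y‖ ≤ R := Set.forall_mem_range.2 hx
  have hsparse : ∀ w, ∃ τ : Fin k → κ, w ∈ convexHull ℝ (Set.range x) →
      ‖(k : ℝ) • w - ∑ t, x (τ t)‖ ^ 2 ≤ k * R ^ 2 := by
    intro w
    by_cases hw : w ∈ convexHull ℝ (Set.range x)
    · obtain ⟨τ, hτ⟩ := exists_norm_smul_sub_sum_sq_le hs hw k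
      choose i hi using fun t => (τ t).2
      exact ⟨i, fun _ => by simpa only [hi] using hτ⟩
    · exact ⟨fun _ => Classical.arbitrary κ, fun h => absurd h hw⟩
  choose c hc using hsparse
  refine ⟨c, fun w hw w' hw' hcc => ?_⟩
  have hmul := mul_norm_sub_sq_le (hc w hw) (hcc ▸ hc w' hw')
  have hdiam : ‖w - w'‖ ^ 2 ≤ 4 * R ^ 2 := by
    have hle : ‖w - w'‖ ≤ R + R := (norm_sub_le _ _).trans
      (add_le_add (norm_le_of_mem_convexHull hs hw) (norm_le_of_mem_convexHull hs hw'))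
    nlinarith [norm_nonneg (w - w')]
  linarith

end Maurey

section EntrywiseNorm

variable {ι : Type*} [Fintype ι] [DecidableEq ι] {a : ℝ}

/-- The extreme points `± a e_i` of the `ℓ¹` ball of radius `a`. -/
noncomputable def l1Vertex (a : ℝ) (x : ι × ℤˣ) : EuclideanSpace ℝ ι :=
  EuclideanSpace.single x.1 (x.2 • a)

theorem norm_l1Vertex (ha : 0 ≤ a) (x : ι × ℤˣ) : ‖l1Vertex a x‖ = a :=
  (PiLp.norm_single 2 _ _ _).trans <| by rw [Real.norm_eq_abs, abs_units_smul, abs_of_nonneg ha]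

theorem sum_smul_l1Vertex {w : EuclideanSpace ℝ ι} (hw : ∑ i, |w i| ≤ a) (p : ι → ℝ) :
    ∑ x : ι × ℤˣ, ((p x.1 + x.2 • (w x.1 / a)) / 2) • l1Vertex a x = w := by
  ext i
  have hcancel : w i / a * a = w i := div_mul_cancel_of_imp fun ha => by
    have hle : |w i| ≤ 0 := (Finset.single_le_sum (fun j _ => abs_nonneg (w j))
      (Finset.mem_univ i)).trans (ha ▸ hw)
    exact abs_nonpos_iff.1 hle
  have hterm : ∀ j, ((p j + w j / a) / 2 * Pi.single (M := fun _ => ℝ) j a i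
      + (p j - w j / a) / 2 * Pi.single (M := fun _ => ℝ) j (-a) i)
      = if i = j then w i else 0 := fun j => by
    rcases eq_or_ne i j with rfl | hij
    · simp only [Pi.single_eq_same, if_true]
      linear_combination hcancel
    · simp [hij]
  simpa [Fintype.sum_prod_type, UnitsInt.univ, l1Vertex, ← sub_eq_add_neg] using
    Fintype.sum_congr _ _ hterm

theorem mem_convexHull_range_l1Vertex [Nonempty ι] {w : EuclideanSpace ℝ ι}
    (hw : ∑ i, |w i| ≤ a) : w ∈ convexHull ℝ (Set.range (l1Vertex (ι := ι) a)) := by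
  have ha : 0 ≤ a := (Finset.sum_nonneg fun i _ => abs_nonneg (w i)).trans hw
  set slack : ℝ := (1 - ∑ i, |w i| / a) / Fintype.card ι with hslack
  have hslack0 : 0 ≤ slack := by
    refine div_nonneg (sub_nonneg.2 ?_) (Nat.cast_nonneg _)
    rw [← Finset.sum_div]
    exact div_le_one_of_le₀ hw ha
  rw [← sum_smul_l1Vertex hw fun i => |w i| / a + slack]
  refine (convex_convexHull ℝ _).sum_mem (fun x _ => ?_) ?_
    fun x _ => subset_convexHull ℝ _ (Set.mem_range_self x)
  · have hneg := neg_abs_le (x.2 • (w x.1 / a))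
    rw [abs_units_smul, abs_div, abs_of_nonneg ha] at hneg
    linarith
  · calc ∑ x : ι × ℤˣ, (|w x.1| / a + slack + x.2 • (w x.1 / a)) / 2
        = ∑ i, (|w i| / a + slack) := by
          rw [Fintype.sum_prod_type]
          refine Fintype.sum_congr _ _ fun i => ?_
          simp only [UnitsInt.univ, Finset.sum_pair (show (1 : ℤˣ) ≠ -1 by decide), one_smul,
            Units.neg_smul]
          ring
      _ = 1 := by
          rw [Finset.sum_add_distrib, Finset.sum_const, Finset.card_univ, nsmul_eq_mul, hslack,
            mul_div_cancel₀ _ (Nat.cast_ne_zero.2 Fintype.card_ne_zero), add_sub_cancel]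

omit [DecidableEq ι] in
theorem exists_code_norm_sub_sq_le_of_sum_abs_le {κ : Type*} [Fintype κ]
    (hκ : 2 * Fintype.card ι ≤ Fintype.card κ) [Nonempty κ] (ha : 0 ≤ a) (k : ℕ) :
    ∃ c : EuclideanSpace ℝ ι → Fin k → κ, ∀ w w', ∑ i, |w i| ≤ a → ∑ i, |w' i| ≤ a →
      c w = c w' → (k + 1) * ‖w - w'‖ ^ 2 ≤ 8 * a ^ 2 := by
  classical
  rcases isEmpty_or_nonempty ι with hι | hι
  · exact ⟨fun _ _ => Classical.arbitrary κ, fun w w' _ _ _ => by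
      simpa [Subsingleton.elim w w'] using sq_nonneg a⟩
  have hcard : Fintype.card (ι × ℤˣ) ≤ Fintype.card κ := by
    rwa [Fintype.card_prod, Fintype.card_units_int, mul_comm]
  obtain ⟨emb⟩ := Function.Embedding.nonempty_of_card_le hcard
  obtain ⟨c, hc⟩ := exists_code_norm_sub_sq_le
    (fun i => (norm_l1Vertex ha (Function.invFun emb i)).le) k
  have hrange : Set.range (fun i => l1Vertex a (Function.invFun emb i))
      = Set.range (l1Vertex (ι := ι) a) :=
    (Function.invFun_surjective emb.injective).range_comp (l1Vertex a)
  rw [hrange] at hc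
  exact ⟨c, fun w w' hw hw' =>
    hc w (mem_convexHull_range_l1Vertex hw) w' (mem_convexHull_range_l1Vertex hw')⟩

end EntrywiseNorm

section Frobenius

/-- The entries of a matrix as a Euclidean vector: `‖entries A‖` is the Frobenius norm of `A`. -/
def entries {ι κ : Type*} (A : Matrix ι κ ℝ) : EuclideanSpace ℝ (ι × κ) :=
  WithLp.toLp 2 (Function.uncurry A)

theorem norm_toEuclideanLin_le {ι κ : Type*} [Fintype ι] [Fintype κ] [DecidableEq κ]
    (A : Matrix ι κ ℝ) (x : EuclideanSpace ℝ κ) :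
    ‖Matrix.toEuclideanLin A x‖ ≤ ‖entries A‖ * ‖x‖ := by
  refine le_of_sq_le_sq ?_ (by positivity)
  rw [mul_pow, EuclideanSpace.real_norm_sq_eq, EuclideanSpace.real_norm_sq_eq,
    EuclideanSpace.real_norm_sq_eq, Fintype.sum_prod_type, Finset.sum_mul]
  exact Finset.sum_le_sum fun i _ => Finset.sum_mul_sq_le_sq_mul_sq _ _ _

theorem norm_toEuclideanLin_le_of_matSpectralNorm_le {p q : ℕ} {A : Matrix (Fin p) (Fin q) ℝ}
    {s : ℝ} (hA : matSpectralNorm A ≤ s) (x : Vec q) : ‖Matrix.toEuclideanLin A x‖ ≤ s * ‖x‖ :=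
  ((LinearMap.toContinuousLinearMap (Matrix.toEuclideanLin A)).le_opNorm x).trans
    (mul_le_mul_of_nonneg_right hA (norm_nonneg x))

theorem sum_abs_entries {p q : ℕ} (A : Matrix (Fin p) (Fin q) ℝ) :
    ∑ i, |entries A i| = entrywiseL1 A :=
  Fintype.sum_prod_type _

end Frobenius

section Network

variable {L : ℕ} {m : Fin (L + 1) → ℕ} {ρ : Fin L → ℝ≥0} {σ : Activations m} {s : Fin L → ℝ}
  {W W' : Weights m}

theorem layerOutput_succ (σ : Activations m) (W : Weights m) (i : Fin L) (x : Vec (m 0)) :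
    layerOutput σ W i.succ x
      = σ i (Matrix.toEuclideanLin (W i) (layerOutput σ W i.castSucc x)) := by
  rw [layerOutput, Fin.induction_succ, ← layerOutput]

theorem norm_layerOutput_le (hσ : ∀ i, LipschitzWith (ρ i) (σ i)) (hσ0 : ∀ i, σ i 0 = 0)
    (hW : ∀ l, matSpectralNorm (W l) ≤ s l) (x : Vec (m 0)) (i : Fin (L + 1)) :
    ‖layerOutput σ W i x‖ ≤ Fin.partialProd (fun l => ρ l * s l) i * ‖x‖ := by
  induction i using Fin.induction with
  | zero => simp [layerOutput]
  | succ i ih =>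
    have hs : 0 ≤ s i := (norm_nonneg _).trans (hW i)
    rw [layerOutput_succ, Fin.partialProd_succ]
    set g := layerOutput σ W i.castSucc x
    set P := Fin.partialProd (fun l => ρ l * s l) i.castSucc
    calc ‖σ i (Matrix.toEuclideanLin (W i) g)‖
        ≤ ρ i * ‖Matrix.toEuclideanLin (W i) g‖ := (hσ i).norm_le_mul (hσ0 i) _
      _ ≤ ρ i * (s i * ‖g‖) := by
          gcongr; exact norm_toEuclideanLin_le_of_matSpectralNorm_le (hW i) g
      _ ≤ ρ i * (s i * (P * ‖x‖)) := by gcongr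
      _ = P * (ρ i * s i) * ‖x‖ := by ring

theorem norm_layerOutput_sub_le (hσ : ∀ i, LipschitzWith (ρ i) (σ i)) (hσ0 : ∀ i, σ i 0 = 0)
    (hs : ∀ l, 0 < s l) (hW : ∀ l, matSpectralNorm (W l) ≤ s l)
    (hW' : ∀ l, matSpectralNorm (W' l) ≤ s l) (x : Vec (m 0)) (i : Fin (L + 1)) :
    ‖layerOutput σ W i x - layerOutput σ W' i x‖ ≤ Fin.partialProd (fun l => ρ l * s l) i * ‖x‖ *
      Fin.partialSum (fun l => ‖entries (W l - W' l)‖ / s l) i := by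
  induction i using Fin.induction with
  | zero => simp [layerOutput]
  | succ i ih =>
    have hsi := hs i
    have hg' := norm_layerOutput_le hσ hσ0 hW' x i.castSucc
    rw [layerOutput_succ, layerOutput_succ, Fin.partialProd_succ, Fin.partialSum_succ]
    set g := layerOutput σ W i.castSucc x
    set g' := layerOutput σ W' i.castSucc x
    set P := Fin.partialProd (fun l => ρ l * s l) i.castSucc
    set R := Fin.partialSum (fun l => ‖entries (W l - W' l)‖ / s l) i.castSucc
    have hsplit : Matrix.toEuclideanLin (W i) g - Matrix.toEuclideanLin (W' i) g'
        = Matrix.toEuclideanLin (W i) (g - g') + Matrix.toEuclideanLin (W i - W' i) g' := by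
      simp only [map_sub, LinearMap.sub_apply]
      abel
    calc ‖σ i (Matrix.toEuclideanLin (W i) g) - σ i (Matrix.toEuclideanLin (W' i) g')‖
        ≤ ρ i * (‖Matrix.toEuclideanLin (W i) (g - g')‖
            + ‖Matrix.toEuclideanLin (W i - W' i) g'‖) := by
          refine ((hσ i).norm_sub_le _ _).trans ?_
          rw [hsplit]
          gcongr
          exact norm_add_le _ _
      _ ≤ ρ i * (s i * ‖g - g'‖ + ‖entries (W i - W' i)‖ * ‖g'‖) := by
          gcongr
          · exact norm_toEuclideanLin_le_of_matSpectralNorm_le (hW i) _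
          · exact norm_toEuclideanLin_le _ _
      _ ≤ ρ i * (s i * (P * ‖x‖ * R) + ‖entries (W i - W' i)‖ * (P * ‖x‖)) := by gcongr
      _ = P * (ρ i * s i) * ‖x‖ * (R + ‖entries (W i - W' i)‖ / s i) := by
          field_simp

/-- The normalized Frobenius distance `∑ ‖W_l - W'_l‖_F / s_l` of two weights, with respect to
which the networks with spectral norm bounds `s` are Lipschitz. -/
noncomputable def weightDist (s : Fin L → ℝ) (W W' : Weights m) : ℝ :=
  ∑ l, ‖entries (W l - W' l)‖ / s l

theorem weightDist_nonneg (hs : ∀ l, 0 < s l) (W W' : Weights m) : 0 ≤ weightDist s W W' :=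
  Finset.sum_nonneg fun l _ => div_nonneg (norm_nonneg _) (hs l).le

theorem weightDist_self (W : Weights m) : weightDist s W W = 0 := by
  simp [weightDist, show entries 0 = 0 from rfl]

theorem continuous_weightDist_right (W : Weights m) : Continuous (weightDist s W) := by
  unfold weightDist entries
  fun_prop

theorem norm_net_sub_le (hσ : ∀ i, LipschitzWith (ρ i) (σ i)) (hσ0 : ∀ i, σ i 0 = 0)
    (hs : ∀ l, 0 < s l) (hW : ∀ l, matSpectralNorm (W l) ≤ s l)
    (hW' : ∀ l, matSpectralNorm (W' l) ≤ s l) (x : Vec (m 0)) :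
    ‖net σ W x - net σ W' x‖ ≤ (∏ l, ρ l * s l) * ‖x‖ * weightDist s W W' := by
  have h := norm_layerOutput_sub_le hσ hσ0 hs hW hW' x (Fin.last L)
  rwa [Fin.partialProd, Fin.partialSum, List.take_of_length_le (by simp),
    List.take_of_length_le (by simp), List.prod_ofFn, List.sum_ofFn] at h

theorem continuous_net (hσ : ∀ i, LipschitzWith (ρ i) (σ i)) (x : Vec (m 0)) :
    Continuous fun W : Weights m => net σ W x := by
  suffices h : ∀ i, Continuous fun W : Weights m => layerOutput σ W i x from h _
  intro i
  induction i using Fin.induction with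
  | zero => exact continuous_const
  | succ i ih =>
    simp only [layerOutput_succ]
    refine (hσ i).continuous.comp ?_
    change Continuous fun W : Weights m =>
      WithLp.toLp 2 ((W i).mulVec (layerOutput σ W i.castSucc x).ofLp)
    fun_prop

end Network

section RobustLoss

variable {L : ℕ} {m : Fin (L + 1) → ℕ} {ρ : Fin L → ℝ≥0} {σ : Activations m} {s : Fin L → ℝ}
  {B : Vec (m 0) → Set (Vec (m 0))} {r : ℝ≥0}
  {loss : Vec (m (Fin.last L)) → Fin (m (Fin.last L)) → ℝ}

theorem robustLoss_mem_Icc (h01 : ∀ v y, loss v y ∈ Set.Icc (0 : ℝ) 1)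
    (W : Weights m) (p : Example m) : robustLoss loss B σ W p ∈ Set.Icc (0 : ℝ) 1 :=
  ⟨Real.iSup_nonneg fun _ => (h01 _ _).1, Real.iSup_le (fun _ => (h01 _ _).2) zero_le_one⟩

theorem abs_robustLoss_sub_le (hσ : ∀ i, LipschitzWith (ρ i) (σ i)) (hσ0 : ∀ i, σ i 0 = 0)
    (hs : ∀ l, 0 < s l) (hLip : ∀ y, LipschitzWith r fun v => loss v y)
    {W W' : Weights m} (hW : ∀ l, matSpectralNorm (W l) ≤ s l)
    (hW' : ∀ l, matSpectralNorm (W' l) ≤ s l) {p : Example m} (hB : (B p.1).Nonempty) {Btil : ℝ}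
    (hp : ∀ x' ∈ B p.1, ‖x'‖ ≤ Btil) :
    |robustLoss loss B σ W p - robustLoss loss B σ W' p|
      ≤ Btil * r * (∏ l, ρ l * s l) * weightDist s W W' := by
  have := hB.to_subtype
  have hprod : 0 ≤ ∏ l, ρ l * s l := Finset.prod_nonneg fun l _ => mul_nonneg (ρ l).2 (hs l).le
  refine abs_iSup_sub_iSup_le fun x' => ?_
  calc |loss (net σ W x') p.2 - loss (net σ W' x') p.2|
      ≤ r * ‖net σ W x' - net σ W' x'‖ := (hLip p.2).norm_sub_le _ _
    _ ≤ r * ((∏ l, ρ l * s l) * ‖(x' : Vec (m 0))‖ * weightDist s W W') := by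
        gcongr
        exact norm_net_sub_le hσ hσ0 hs hW hW' x'
    _ ≤ r * ((∏ l, ρ l * s l) * Btil * weightDist s W W') := by
        have := weightDist_nonneg hs W W'
        gcongr
        exact hp x' x'.2
    _ = Btil * r * (∏ l, ρ l * s l) * weightDist s W W' := by ring

end RobustLoss

section Entropy

variable {L : ℕ} {s a : Fin L → ℝ}

/-- The contribution `a_l^(2/3) / s_l^(2/3)` of layer `l` to the complexity of the weight class. -/
noncomputable def layerCost (s a : Fin L → ℝ) (l : Fin L) : ℝ :=
  a l ^ (2 / 3 : ℝ) / s l ^ (2 / 3 : ℝ)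

/-- The number of vertices allotted to layer `l` at scale `2⁻ʲ`. Lengths proportional to the costs
minimize the distance of weights with equal codes for a given total length; the factor `1 / 2`
makes the lengths vanish at scale `1`. -/
noncomputable def codeLength (s a : Fin L → ℝ) (j : ℕ) (l : Fin L) : ℕ :=
  ⌊4 ^ j * (layerCost s a l / (2 * ∑ i, layerCost s a i))⌋₊

theorem rpow_three_halves {x : ℝ} (hx : 0 ≤ x) : x ^ (3 / 2 : ℝ) = √x * x := by
  rw [Real.sqrt_eq_rpow, ← Real.rpow_add_one' hx (by norm_num)]
  norm_num

theorem sum_layerCost_div_le (s a : Fin L → ℝ) :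
    ∑ l, layerCost s a l / (2 * ∑ i, layerCost s a i) ≤ 1 / 2 := by
  rw [← Finset.sum_div, mul_comm, ← div_div]
  gcongr
  exact div_self_le_one _

section LayerCost

variable (hs : ∀ l, 0 < s l) (ha : ∀ l, 0 ≤ a l)
include hs ha

theorem layerCost_nonneg (l : Fin L) : 0 ≤ layerCost s a l :=
  div_nonneg (Real.rpow_nonneg (ha l) _) (Real.rpow_nonneg (hs l).le _)

theorem layerCost_pow_three (l : Fin L) : layerCost s a l ^ 3 = (a l / s l) ^ 2 := by
  rw [layerCost, ← Real.div_rpow (ha l) (hs l).le, ← Real.rpow_mul_natCast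
    (div_nonneg (ha l) (hs l).le), ← Real.rpow_natCast]
  norm_num

theorem sum_layerCost_nonneg : 0 ≤ ∑ l, layerCost s a l :=
  Finset.sum_nonneg fun l _ => layerCost_nonneg hs ha l

theorem layerCost_div_nonneg (l : Fin L) : 0 ≤ layerCost s a l / (2 * ∑ i, layerCost s a i) :=
  div_nonneg (layerCost_nonneg hs ha l) (mul_nonneg zero_le_two (sum_layerCost_nonneg hs ha))

theorem codeLength_zero (l : Fin L) : codeLength s a 0 l = 0 := by
  have hle := (Finset.single_le_sum (fun l _ => layerCost_div_nonneg hs ha l)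
    (Finset.mem_univ l)).trans (sum_layerCost_div_le s a)
  rw [codeLength, Nat.floor_eq_zero]
  linarith

theorem sum_codeLength_le (j : ℕ) : ((∑ l, codeLength s a j l : ℕ) : ℝ) ≤ 4 ^ j := by
  push_cast
  calc ∑ l, (codeLength s a j l : ℝ)
      ≤ ∑ l, 4 ^ j * (layerCost s a l / (2 * ∑ i, layerCost s a i)) :=
        Finset.sum_le_sum fun l _ =>
          Nat.floor_le (mul_nonneg (by positivity) (layerCost_div_nonneg hs ha l))
    _ ≤ 4 ^ j * 1 := by
        rw [← Finset.mul_sum]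
        gcongr
        linarith [sum_layerCost_div_le s a]
    _ = 4 ^ j := mul_one _

theorem four_pow_mul_layerCost_le (j : ℕ) (l : Fin L) :
    4 ^ j * layerCost s a l ≤ 2 * (∑ i, layerCost s a i) * (codeLength s a j l + 1) := by
  rcases (sum_layerCost_nonneg hs ha).eq_or_lt with h | h
  · rw [(Finset.sum_eq_zero_iff_of_nonneg fun l _ => layerCost_nonneg hs ha l).1 h.symm l
      (Finset.mem_univ l), ← h]
    simp
  · have hlt := (Nat.lt_floor_add_one
      (4 ^ j * (layerCost s a l / (2 * ∑ i, layerCost s a i)))).le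
    rwa [← mul_div_assoc, div_le_iff₀ (by positivity), mul_div_assoc, ← codeLength,
      mul_comm (_ + 1)] at hlt

end LayerCost

theorem le_sqrt_mul_div_of_mul_sq_le {x c A k N : ℝ} (hc : 0 ≤ c) (hN : 0 < N) (hk : 0 ≤ k)
    (hA : 0 ≤ A) (hlen : N ^ 2 * c ≤ 2 * A * (k + 1)) (hx : (k + 1) * x ^ 2 ≤ 8 * c ^ 3) :
    x ≤ 4 * √A * c / N := by
  refine le_of_sq_le_sq ?_ (by positivity)
  rw [div_pow, mul_pow, mul_pow, Real.sq_sqrt hA, le_div_iff₀ (by positivity)]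
  rcases hc.eq_or_lt with rfl | hc
  · have : x ^ 2 ≤ 0 := by nlinarith
    nlinarith
  · refine le_of_mul_le_mul_right ?_ hc
    calc x ^ 2 * N ^ 2 * c = x ^ 2 * (N ^ 2 * c) := by ring
      _ ≤ x ^ 2 * (2 * A * (k + 1)) := by gcongr
      _ = 2 * A * ((k + 1) * x ^ 2) := by ring
      _ ≤ 2 * A * (8 * c ^ 3) := by gcongr
      _ = 4 ^ 2 * A * c ^ 2 * c := by ring

variable {m : Fin (L + 1) → ℕ}

/-- Codes of the weights at scale `2⁻ʲ`: for each layer `l`, a word of length `codeLength s a j l`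
in an alphabet large enough to name the vertices of the `ℓ¹` ball of each layer. -/
abbrev WeightCode (m : Fin (L + 1) → ℕ) (s a : Fin L → ℝ) (j : ℕ) : Type :=
  (l : Fin L) → Fin (codeLength s a j l) → Fin (2 * maxWidth m ^ 2)

theorem card_weightCode_le (hs : ∀ l, 0 < s l) (ha : ∀ l, 0 ≤ a l) (hm : 0 < maxWidth m) (j : ℕ) :
    (Fintype.card (WeightCode m s a j) : ℝ)
      ≤ Real.exp (4 ^ j * Real.log (2 * (maxWidth m : ℝ) ^ 2)) := by
  have hM : (1 : ℝ) ≤ maxWidth m := by exact_mod_cast hm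
  have hlog : 0 ≤ Real.log (2 * (maxWidth m : ℝ) ^ 2) := Real.log_nonneg (by nlinarith)
  have hcard : (Fintype.card (WeightCode m s a j) : ℝ)
      = (2 * (maxWidth m : ℝ) ^ 2) ^ ∑ l, codeLength s a j l := by
    simp [Fintype.card_pi, Finset.prod_pow_eq_pow_sum]
  rw [hcard, ← Real.rpow_natCast, Real.rpow_def_of_pos (by positivity), mul_comm]
  gcongr
  exact sum_codeLength_le hs ha j

theorem exists_code_norm_entries_sub_sq_le {p q M : ℕ} (hM : 0 < M) (hp : p ≤ M) (hq : q ≤ M)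
    {r : ℝ} (hr : 0 ≤ r) (k : ℕ) :
    ∃ c : Matrix (Fin p) (Fin q) ℝ → Fin k → Fin (2 * M ^ 2), ∀ A A',
      entrywiseL1 A ≤ r → entrywiseL1 A' ≤ r → c A = c A' →
        (k + 1) * ‖entries (A - A')‖ ^ 2 ≤ 8 * r ^ 2 := by
  have : NeZero (2 * M ^ 2) := ⟨by positivity⟩
  have hcard : 2 * Fintype.card (Fin p × Fin q) ≤ Fintype.card (Fin (2 * M ^ 2)) := by
    simp only [Fintype.card_prod, Fintype.card_fin, sq]
    gcongr
  obtain ⟨c, hc⟩ := exists_code_norm_sub_sq_le_of_sum_abs_le hcard hr k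
  exact ⟨fun A => c (entries A), fun A A' hA hA' =>
    hc _ _ ((sum_abs_entries A).trans_le hA) ((sum_abs_entries A').trans_le hA')⟩

theorem exists_weightCode_weightDist_le (hs : ∀ l, 0 < s l) (ha : ∀ l, 0 ≤ a l)
    (hm : 0 < maxWidth m) (j : ℕ) :
    ∃ c : Weights m → WeightCode m s a j, ∀ W ∈ weightClass m s a, ∀ W' ∈ weightClass m s a,
      c W = c W' →
        weightDist s W W' ≤ 4 * (∑ l, layerCost s a l) ^ (3 / 2 : ℝ) * (1 / 2) ^ j := by
  choose c hc using fun l : Fin L => exists_code_norm_entries_sub_sq_le hm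
    (Finset.le_sup (f := m) (Finset.mem_univ l.succ))
    (Finset.le_sup (f := m) (Finset.mem_univ l.castSucc)) (ha l) (codeLength s a j l)
  refine ⟨fun W l => c l (W l), fun W hW W' hW' hcc => ?_⟩
  set A := ∑ l, layerCost s a l
  have hA : 0 ≤ A := sum_layerCost_nonneg hs ha
  have hfour : ((2 : ℝ) ^ j) ^ 2 = 4 ^ j := by rw [← pow_mul, mul_comm j, pow_mul]; norm_num
  have hlayer (l : Fin L) :
      ‖entries (W l - W' l)‖ / s l ≤ 4 * √A * layerCost s a l / 2 ^ j := by
    have hcode := hc l _ _ (hW l).2 (hW' l).2 (congrFun hcc l)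
    refine le_sqrt_mul_div_of_mul_sq_le (k := codeLength s a j l) (layerCost_nonneg hs ha l)
      (by positivity) (Nat.cast_nonneg _) hA ?_ ?_
    · rw [hfour]
      exact four_pow_mul_layerCost_le hs ha j l
    · rw [layerCost_pow_three hs ha, div_pow, div_pow, ← mul_div_assoc, ← mul_div_assoc]
      gcongr
  calc weightDist s W W' ≤ ∑ l, 4 * √A * layerCost s a l / 2 ^ j :=
        Finset.sum_le_sum fun l _ => hlayer l
    _ = 4 * A ^ (3 / 2 : ℝ) * (1 / 2) ^ j := by
        rw [← Finset.sum_div, ← Finset.mul_sum, rpow_three_halves hA, one_div_pow]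
        ring

end Entropy

section Complexity

variable {L : ℕ} {m : Fin (L + 1) → ℕ} {ρ : Fin L → ℝ≥0} {σ : Activations m} {s a : Fin L → ℝ}
  {B : Vec (m 0) → Set (Vec (m 0))}

theorem BoundsAdversarial.nonneg (hB : ∀ x, (B x).Nonempty) {n : ℕ} (hn : 0 < n)
    {S : Fin n → Example m} {Btil : ℝ} (h : BoundsAdversarial B S Btil) : 0 ≤ Btil := by
  obtain ⟨x', hx'⟩ := hB (S ⟨0, hn⟩).1
  exact (norm_nonneg _).trans (h _ _ hx')

theorem maxWidth_pos (p : Example m) : 0 < maxWidth m :=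
  p.2.pos.trans_le (Finset.le_sup (Finset.mem_univ (Fin.last L)))

theorem subsingleton_weightCode_zero (hs : ∀ l, 0 < s l) (ha : ∀ l, 0 ≤ a l) :
    Subsingleton (WeightCode m s a 0) := by
  have (l : Fin L) : IsEmpty (Fin (codeLength s a 0 l)) := by
    rw [codeLength_zero hs ha]
    infer_instance
  infer_instance

theorem rademacherComplexity_robustLoss_le (hσ : ∀ i, LipschitzWith (ρ i) (σ i))
    (hσ0 : ∀ i, σ i 0 = 0) (hs : ∀ l, 0 < s l) (ha : ∀ l, 0 ≤ a l) (hB : ∀ x, (B x).Nonempty)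
    {r : ℝ≥0} {loss : Vec (m (Fin.last L)) → Fin (m (Fin.last L)) → ℝ}
    (hLip : ∀ y, LipschitzWith r fun v => loss v y)
    {T : Type*} [Nonempty T] {w : T → Weights m} (hw : ∀ t, w t ∈ weightClass m s a)
    {n : ℕ} (hn : 0 < n) {S : Fin n → Example m} {Btil : ℝ} (hS : BoundsAdversarial B S Btil) :
    rademacherComplexity (fun t i => robustLoss loss B σ (w t) (S i))
      ≤ 48 * (Btil * r * (∏ l, ρ l * s l) * (∑ l, layerCost s a l) ^ (3 / 2 : ℝ)
        * √(n * Real.log (2 * (maxWidth m : ℝ) ^ 2)) * (1 + Real.log n)) := by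
  have : Nonempty (Fin n) := ⟨⟨0, hn⟩⟩
  have : Subsingleton (WeightCode m s a 0) := subsingleton_weightCode_zero hs ha
  have hm : 0 < maxWidth m := maxWidth_pos (S ⟨0, hn⟩)
  have hM : (1 : ℝ) ≤ maxWidth m := by exact_mod_cast hm
  have hlog : Real.log 2 ≤ Real.log (2 * (maxWidth m : ℝ) ^ 2) :=
    Real.log_le_log two_pos (by nlinarith)
  have hscale : 0 ≤ Btil * r * ∏ l, ρ l * s l :=
    mul_nonneg (mul_nonneg (hS.nonneg hB hn) r.2)
      (Finset.prod_nonneg fun l _ => mul_nonneg (ρ l).2 (hs l).le)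
  have hcost := sum_layerCost_nonneg hs ha
  choose c hc using exists_weightCode_weightDist_le hs ha hm
  have hclose (j : ℕ) (t t' : T) (h : c j (w t) = c j (w t')) (i : Fin n) :
      |robustLoss loss B σ (w t) (S i) - robustLoss loss B σ (w t') (S i)|
        ≤ Btil * r * (∏ l, ρ l * s l) * (4 * (∑ l, layerCost s a l) ^ (3 / 2 : ℝ))
          * (1 / 2) ^ j := by
    refine (abs_robustLoss_sub_le hσ hσ0 hs hLip (fun l => (hw t l).1) (fun l => (hw t' l).1)
      (hB _) (hS i)).trans ?_
    rw [mul_assoc _ (4 * _)]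
    gcongr
    exact hc j _ (hw t) _ (hw t') h
  refine (rademacherComplexity_le_of_codes (by positivity) hlog (card_weightCode_le hs ha hm)
    hclose).trans_eq ?_
  rw [Fintype.card_fin]
  ring

theorem two_div_mul_rademacherComplexity_robustLoss_le (hσ : ∀ i, LipschitzWith (ρ i) (σ i))
    (hσ0 : ∀ i, σ i 0 = 0) (hs : ∀ l, 0 < s l) (ha : ∀ l, 0 ≤ a l) (hB : ∀ x, (B x).Nonempty)
    {r : ℝ≥0} {loss : Vec (m (Fin.last L)) → Fin (m (Fin.last L)) → ℝ}
    (hLip : ∀ y, LipschitzWith r fun v => loss v y)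
    {T : Type*} [Nonempty T] {w : T → Weights m} (hw : ∀ t, w t ∈ weightClass m s a)
    {n : ℕ} (hn : 0 < n) {S : Fin n → Example m} {Btil : ℝ} (hS : BoundsAdversarial B S Btil) :
    2 / n * rademacherComplexity (fun t i => robustLoss loss B σ (w t) (S i))
      ≤ 96 * (logFactor n (maxWidth m) * leadingTerm n Btil r (fun i => (ρ i : ℝ)) s a) := by
  have hsqrt (x : ℝ) : √(n * x) / n = √x / √n := by
    rw [Real.sqrt_mul n.cast_nonneg, mul_comm, mul_div_assoc, Real.sqrt_div_self, ← div_eq_mul_inv]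
  calc 2 / n * rademacherComplexity (fun t i => robustLoss loss B σ (w t) (S i))
      ≤ 2 / n * (48 * (Btil * r * (∏ l, ρ l * s l) * (∑ l, layerCost s a l) ^ (3 / 2 : ℝ)
          * √(n * Real.log (2 * (maxWidth m : ℝ) ^ 2)) * (1 + Real.log n))) := by
        gcongr
        exact rademacherComplexity_robustLoss_le hσ hσ0 hs ha hB hLip hw hn hS
    _ = 96 * (Btil * r * (∏ l, ρ l * s l) * (∑ l, layerCost s a l) ^ (3 / 2 : ℝ)
          * (√(n * Real.log (2 * (maxWidth m : ℝ) ^ 2)) / n) * (1 + Real.log n)) := by ring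
    _ = 96 * (logFactor n (maxWidth m) * leadingTerm n Btil r (fun i => (ρ i : ℝ)) s a) := by
        simp only [hsqrt, logFactor, leadingTerm, layerCost]
        ring

theorem logFactor_mul_leadingTerm_nonneg {n M : ℕ} {Btil r : ℝ} (hBtil : 0 ≤ Btil)
    (hr : 0 ≤ r) (hs : ∀ l, 0 < s l) (ha : ∀ l, 0 ≤ a l) :
    0 ≤ logFactor n M * leadingTerm n Btil r (fun i => (ρ i : ℝ)) s a := by
  have hprod : 0 ≤ ∏ l, ρ l * s l := Finset.prod_nonneg fun l _ => mul_nonneg (ρ l).2 (hs l).le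
  have hcost : 0 ≤ ∑ l, a l ^ (2 / 3 : ℝ) / s l ^ (2 / 3 : ℝ) := sum_layerCost_nonneg hs ha
  unfold logFactor leadingTerm
  positivity

end Complexity

section Approximation

theorem integral_le_of_eventually_lt {Ω : Type*} [MeasurableSpace Ω] {D : Measure Ω}
    [IsProbabilityMeasure D] {f : ℕ → Ω → ℝ} {g : Ω → ℝ} (hf : ∀ k, AEMeasurable (f k) D)
    (hg : AEMeasurable g D) (hf01 : ∀ k x, f k x ∈ Set.Icc (0 : ℝ) 1)
    (hg01 : ∀ x, g x ∈ Set.Icc (0 : ℝ) 1)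
    (hlsc : ∀ x, ∀ c < g x, ∀ᶠ k in Filter.atTop, c < f k x) {b : ℕ → ℝ} {b' : ℝ}
    (hb : Filter.Tendsto b Filter.atTop (nhds b')) (hfb : ∀ k, ∫ x, f k x ∂D ≤ b k) :
    ∫ x, g x ∂D ≤ b' := by
  -- Truncating `f k` at `g` turns the one-sided convergence into convergence.
  have hmeas (k : ℕ) : AEMeasurable (fun x => min (f k x) (g x)) D := (hf k).min hg
  have hmin (k : ℕ) (x : Ω) : min (f k x) (g x) ∈ Set.Icc (0 : ℝ) 1 :=
    ⟨le_min (hf01 k x).1 (hg01 x).1, (min_le_left _ _).trans (hf01 k x).2⟩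
  have hpointwise (x : Ω) :
      Filter.Tendsto (fun k => min (f k x) (g x)) Filter.atTop (nhds (g x)) :=
    tendsto_order.2 ⟨fun c hc => (hlsc x c hc).mono fun k hk => lt_min hk hc,
      fun c hc => .of_forall fun k => (min_le_right _ _).trans_lt hc⟩
  have hlim : Filter.Tendsto (fun k => ∫ x, min (f k x) (g x) ∂D) Filter.atTop
      (nhds (∫ x, g x ∂D)) := by
    refine tendsto_integral_of_dominated_convergence (fun _ => 1)
      (fun k => (hmeas k).aestronglyMeasurable) (integrable_const _)
      (fun k => .of_forall fun x => ?_) (.of_forall hpointwise)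
    rw [Real.norm_of_nonneg (hmin k x).1]
    exact (hmin k x).2
  refine le_of_tendsto_of_tendsto' hlim hb fun k => le_trans ?_ (hfb k)
  exact integral_mono (Integrable.of_mem_Icc 0 1 (hmeas k) (.of_forall (hmin k)))
    (Integrable.of_mem_Icc 0 1 (hf k) (.of_forall (hf01 k))) fun x => min_le_left _ _

variable {L : ℕ} {m : Fin (L + 1) → ℕ} {ρ : Fin L → ℝ≥0} {σ : Activations m} {s a : Fin L → ℝ}
  {B : Vec (m 0) → Set (Vec (m 0))} {r : ℝ≥0}
  {loss : Vec (m (Fin.last L)) → Fin (m (Fin.last L)) → ℝ}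

theorem zero_mem_weightClass (hs : ∀ l, 0 < s l) (ha : ∀ l, 0 ≤ a l) :
    (0 : Weights m) ∈ weightClass m s a := fun l => by
  simp [matSpectralNorm, entrywiseL1, (hs l).le, ha l]

theorem exists_dense_seq_weightClass (hs : ∀ l, 0 < s l) (ha : ∀ l, 0 ≤ a l) :
    ∃ w : ℕ → Weights m, (∀ j, w j ∈ weightClass m s a) ∧
      ∀ W ∈ weightClass m s a, ∃ u : ℕ → ℕ,
        Filter.Tendsto (fun k => w (u k)) Filter.atTop (nhds W) := by
  have : Nonempty (weightClass m s a) := ⟨⟨0, zero_mem_weightClass hs ha⟩⟩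
  have : SecondCountableTopology (Weights m) :=
    inferInstanceAs (SecondCountableTopology
      ((i : Fin L) → Fin (m i.succ) → Fin (m i.castSucc) → ℝ))
  refine ⟨fun j => TopologicalSpace.denseSeq (weightClass m s a) j, fun j => Subtype.property _,
    fun W hW => ?_⟩
  obtain ⟨x, hx, hxW⟩ := mem_closure_iff_seq_limit.1
    (TopologicalSpace.denseRange_denseSeq (weightClass m s a) ⟨W, hW⟩)
  choose u hu using hx
  obtain rfl : (fun k => TopologicalSpace.denseSeq (weightClass m s a) (u k)) = x := funext hu
  exact ⟨u, (continuous_subtype_val.tendsto _).comp hxW⟩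

theorem tendsto_robustLoss (hσ : ∀ i, LipschitzWith (ρ i) (σ i)) (hσ0 : ∀ i, σ i 0 = 0)
    (hs : ∀ l, 0 < s l) (hLip : ∀ y, LipschitzWith r fun v => loss v y)
    {w : ℕ → Weights m} {W : Weights m} (hw : ∀ k l, matSpectralNorm (w k l) ≤ s l)
    (hW : ∀ l, matSpectralNorm (W l) ≤ s l) (hwW : Filter.Tendsto w Filter.atTop (nhds W))
    {p : Example m} (hB : (B p.1).Nonempty) {Btil : ℝ} (hp : ∀ x' ∈ B p.1, ‖x'‖ ≤ Btil) :
    Filter.Tendsto (fun k => robustLoss loss B σ (w k) p) Filter.atTop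
      (nhds (robustLoss loss B σ W p)) := by
  have hdist : Filter.Tendsto (fun k => Btil * r * (∏ l, ρ l * s l) * weightDist s W (w k))
      Filter.atTop (nhds 0) := by
    have := (((continuous_weightDist_right (s := s) W).tendsto W).comp hwW).const_mul
      (Btil * r * ∏ l, ρ l * s l)
    rwa [weightDist_self, mul_zero] at this
  rw [tendsto_iff_dist_tendsto_zero]
  refine squeeze_zero (fun _ => dist_nonneg) (fun k => ?_) hdist
  rw [dist_comm, Real.dist_eq]
  exact abs_robustLoss_sub_le hσ hσ0 hs hLip hW (hw k) hB hp

theorem bddAbove_range_loss (h01 : ∀ v y, loss v y ∈ Set.Icc (0 : ℝ) 1) (W : Weights m)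
    (p : Example m) : BddAbove (Set.range fun x' : B p.1 => loss (net σ W x') p.2) :=
  ⟨1, Set.forall_mem_range.2 fun _ => (h01 _ _).2⟩

/-- As `B p.1` may be unbounded, the robust loss is only lower semicontinuous in the weights. -/
theorem eventually_lt_robustLoss (hσ : ∀ i, LipschitzWith (ρ i) (σ i))
    (hLip : ∀ y, LipschitzWith r fun v => loss v y)
    (h01 : ∀ v y, loss v y ∈ Set.Icc (0 : ℝ) 1) {w : ℕ → Weights m} {W : Weights m}
    (hwW : Filter.Tendsto w Filter.atTop (nhds W)) {p : Example m} (hB : (B p.1).Nonempty) {c : ℝ}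
    (hc : c < robustLoss loss B σ W p) :
    ∀ᶠ k in Filter.atTop, c < robustLoss loss B σ (w k) p := by
  have := hB.to_subtype
  obtain ⟨x', hx'⟩ := exists_lt_of_lt_ciSup hc
  have hlim : Filter.Tendsto (fun k => loss (net σ (w k) x') p.2) Filter.atTop
      (nhds (loss (net σ W x') p.2)) :=
    (((hLip p.2).continuous.comp (continuous_net hσ (x' : Vec (m 0)))).tendsto W).comp hwW
  filter_upwards [hlim.eventually_const_lt hx'] with k hk
  exact hk.trans_le (le_ciSup (bddAbove_range_loss h01 (w k) p) x')

theorem robustGap_le_of_tendsto (hσ : ∀ i, LipschitzWith (ρ i) (σ i)) (hσ0 : ∀ i, σ i 0 = 0)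
    (hs : ∀ l, 0 < s l) (hB : ∀ x, (B x).Nonempty) (hLip : ∀ y, LipschitzWith r fun v => loss v y)
    (h01 : ∀ v y, loss v y ∈ Set.Icc (0 : ℝ) 1) {D : Measure (Example m)} [IsProbabilityMeasure D]
    (hMeas : ∀ W ∈ weightClass m s a, AEMeasurable (robustLoss loss B σ W) D)
    {w : ℕ → Weights m} {W : Weights m} (hw : ∀ k, w k ∈ weightClass m s a)
    (hW : W ∈ weightClass m s a) (hwW : Filter.Tendsto w Filter.atTop (nhds W))
    {n : ℕ} {S : Fin n → Example m} {Btil b : ℝ} (hS : BoundsAdversarial B S Btil)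
    (hgap : ∀ k, robustGap loss B σ D S (w k) ≤ b) : robustGap loss B σ D S W ≤ b := by
  have hlim : Filter.Tendsto
      (fun k => b + (1 / (n : ℝ)) * ∑ i, robustLoss loss B σ (w k) (S i)) Filter.atTop
      (nhds (b + (1 / (n : ℝ)) * ∑ i, robustLoss loss B σ W (S i))) :=
    ((tendsto_finsetSum _ fun i _ => tendsto_robustLoss hσ hσ0 hs hLip (fun k l => (hw k l).1)
      (fun l => (hW l).1) hwW (hB _) (hS i)).const_mul _).const_add _
  exact sub_le_iff_le_add.2 <| integral_le_of_eventually_lt (fun k => hMeas _ (hw k)) (hMeas W hW)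
    (fun k => robustLoss_mem_Icc h01 (w k)) (robustLoss_mem_Icc h01 W)
    (fun p c hc => eventually_lt_robustLoss hσ hLip h01 hwW (hB p.1) hc) hlim
    fun k => sub_le_iff_le_add.1 (hgap k)

end Approximation

section Generalization

variable {L : ℕ} {m : Fin (L + 1) → ℕ} {ρ : Fin L → ℝ≥0} {σ : Activations m} {s a : Fin L → ℝ}
  {B : Vec (m 0) → Set (Vec (m 0))}

theorem exists_event_robustGap_le (hσ : ∀ i, LipschitzWith (ρ i) (σ i)) (hσ0 : ∀ i, σ i 0 = 0)
    (hs : ∀ l, 0 < s l) (ha : ∀ l, 0 ≤ a l) (hB : ∀ x, (B x).Nonempty)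
    (D : Measure (Example m)) [IsProbabilityMeasure D] {n : ℕ} (hn : 0 < n) {δ : ℝ}
    (hδ0 : 0 < δ) (hδ1 : δ < 1) {r : ℝ≥0}
    {loss : Vec (m (Fin.last L)) → Fin (m (Fin.last L)) → ℝ}
    (hLip : ∀ y, LipschitzWith r fun v => loss v y)
    (h01 : ∀ v y, loss v y ∈ Set.Icc (0 : ℝ) 1)
    (hMeas : ∀ W ∈ weightClass m s a, AEMeasurable (robustLoss loss B σ W) D) :
    ∃ E : Set (Fin n → Example m), MeasurableSet E ∧
      1 - δ ≤ (Measure.pi (fun _ : Fin n => D)).real E ∧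
      ∀ S ∈ E, ∀ W ∈ weightClass m s a, ∀ Btil : ℝ, BoundsAdversarial B S Btil →
        robustGap loss B σ D S W ≤
          96 * (logFactor n (maxWidth m) * leadingTerm n Btil r (fun i => (ρ i : ℝ)) s a
            + √(Real.log (1 / δ) / n)) := by
  obtain ⟨w, hw, hdense⟩ := exists_dense_seq_weightClass (m := m) hs ha
  obtain ⟨E, hE, hEδ, hdev⟩ := exists_event_integral_sub_le_of_aemeasurable D
    (g := fun j => robustLoss loss B σ (w j)) hn hδ0 hδ1 (fun j => hMeas _ (hw j))
    (fun j => robustLoss_mem_Icc h01 (w j))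
  refine ⟨E, hE, hEδ, fun S hS W hW Btil hBtil => ?_⟩
  obtain ⟨u, hu⟩ := hdense W hW
  refine robustGap_le_of_tendsto hσ hσ0 hs hB hLip h01 hMeas (fun k => hw (u k)) hW hu hBtil
    fun k => (hdev S hS (u k)).trans ?_
  have hcomplexity :=
    two_div_mul_rademacherComplexity_robustLoss_le hσ hσ0 hs ha hB hLip hw hn hBtil
  have hsqrt : √(Real.log (1 / δ) / (2 * n)) ≤ √(Real.log (1 / δ) / n) := by
    have := Real.log_nonneg (one_le_one_div hδ0 hδ1.le)
    gcongr
    linarith [(Nat.cast_pos (α := ℝ)).2 hn]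
  linarith [Real.sqrt_nonneg (Real.log (1 / δ) / n)]

end Generalization

section Ramp

variable {k : ℕ} {γ : ℝ}

/-- The ramp function: `1` on `(-∞, 0]`, `0` on `[γ, ∞)`, affine in between. -/
noncomputable def ramp (γ t : ℝ) : ℝ := max 0 (min 1 (1 - t / γ))

/-- The ramp loss of the scores `v` at the label `y`: the ramp function of the margin
`v y - max_{j ≠ y} v j`, so that it lies between the classification error and the margin error.
With the supremum outside of the ramp, its value is `0` if there is only one class. -/
noncomputable def rampLoss (γ : ℝ) (v : Vec k) (y : Fin k) : ℝ :=
  ⨆ j : {j // j ≠ y}, ramp γ (v y - v j)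

theorem lt_iSup_iff_of_nonneg {T : Sort*} {f : T → ℝ} (hf : BddAbove (Set.range f)) {c : ℝ}
    (hc : 0 ≤ c) : c < ⨆ t, f t ↔ ∃ t, c < f t := by
  refine ⟨fun h => ?_, fun ⟨t, ht⟩ => ht.trans_le (le_ciSup hf t)⟩
  by_contra! hle
  exact h.not_ge (Real.iSup_le hle hc)

theorem ramp_mem_Icc (γ t : ℝ) : ramp γ t ∈ Set.Icc (0 : ℝ) 1 :=
  ⟨le_max_left _ _, max_le zero_le_one (min_le_left _ _)⟩

theorem ramp_of_nonpos (hγ : 0 < γ) {t : ℝ} (ht : t ≤ 0) : ramp γ t = 1 := by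
  rw [ramp, min_eq_left, max_eq_right zero_le_one]
  linarith [div_nonpos_of_nonpos_of_nonneg ht hγ.le]

theorem lt_ramp_iff (hγ : 0 < γ) {t c : ℝ} (hc0 : 0 ≤ c) (hc1 : c < 1) :
    c < ramp γ t ↔ t < γ * (1 - c) := by
  simp only [ramp, lt_max_iff, lt_min_iff, hc1, true_and, not_lt.2 hc0, false_or]
  rw [lt_sub_comm, div_lt_iff₀ hγ, mul_comm]

theorem abs_ramp_sub_le (hγ : 0 < γ) (t t' : ℝ) : |ramp γ t - ramp γ t'| ≤ |t - t'| / γ := by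
  calc |ramp γ t - ramp γ t'| ≤ |min 1 (1 - t / γ) - min 1 (1 - t' / γ)| := by
        simpa [ramp] using abs_max_sub_max_le_max 0 (min 1 (1 - t / γ)) 0 (min 1 (1 - t' / γ))
    _ ≤ |(1 - t / γ) - (1 - t' / γ)| := by
        simpa using abs_min_sub_min_le_max 1 (1 - t / γ) 1 (1 - t' / γ)
    _ = |t - t'| / γ := by
        rw [sub_sub_sub_cancel_left, ← sub_div, abs_div, abs_of_pos hγ, abs_sub_comm]

theorem rampLoss_mem_Icc (γ : ℝ) (v : Vec k) (y : Fin k) : rampLoss γ v y ∈ Set.Icc (0 : ℝ) 1 :=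
  ⟨Real.iSup_nonneg fun _ => (ramp_mem_Icc _ _).1,
    Real.iSup_le (fun _ => (ramp_mem_Icc _ _).2) zero_le_one⟩

theorem lt_rampLoss_iff (hγ : 0 < γ) {c : ℝ} (hc0 : 0 ≤ c) (hc1 : c < 1) (v : Vec k)
    (y : Fin k) : c < rampLoss γ v y ↔ ∃ j, j ≠ y ∧ v y - v j < γ * (1 - c) := by
  rw [rampLoss, lt_iSup_iff_of_nonneg (Set.finite_range _).bddAbove hc0]
  simp only [lt_ramp_iff hγ hc0 hc1, Subtype.exists, exists_prop]

theorem rampLoss_eq_one (hγ : 0 < γ) {v : Vec k} {y j : Fin k} (hj : j ≠ y)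
    (h : v y ≤ v j) : rampLoss γ v y = 1 := by
  refine (rampLoss_mem_Icc γ v y).2.antisymm ?_
  rw [← ramp_of_nonpos hγ (sub_nonpos.2 h)]
  exact le_ciSup (f := fun j : {j // j ≠ y} => ramp γ (v y - v j)) (Set.finite_range _).bddAbove
    ⟨j, hj⟩

theorem lipschitzWith_rampLoss (hγ : 0 < γ) (y : Fin k) :
    LipschitzWith (2 / γ).toNNReal fun v : Vec k => rampLoss γ v y := by
  refine LipschitzWith.of_dist_le' fun v v' => ?_
  rw [Real.dist_eq, dist_eq_norm]
  rcases isEmpty_or_nonempty {j // j ≠ y} with h | h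
  · simp only [rampLoss, Real.iSup_of_isEmpty, sub_self, abs_zero]
    positivity
  refine abs_iSup_sub_iSup_le fun j => ?_
  have hcoord (i : Fin k) : |v i - v' i| ≤ ‖v - v'‖ := by
    simpa using PiLp.norm_apply_le (v - v') i
  calc |ramp γ (v y - v j) - ramp γ (v' y - v' j)|
      ≤ |(v y - v j) - (v' y - v' j)| / γ := abs_ramp_sub_le hγ _ _
    _ ≤ (|v y - v' y| + |v j - v' j|) / γ := by
        rw [sub_sub_sub_comm]
        gcongr
        exact abs_sub _ _
    _ ≤ 2 / γ * ‖v - v'‖ := by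
        rw [div_mul_eq_mul_div]
        gcongr
        linarith [hcoord y, hcoord j]

end Ramp

section Margin

variable {L : ℕ} {m : Fin (L + 1) → ℕ} {ρ : Fin L → ℝ≥0} {σ : Activations m} {s a : Fin L → ℝ}
  {B : Vec (m 0) → Set (Vec (m 0))} {γ : ℝ}

theorem lt_robustLoss_rampLoss_iff (hγ : 0 < γ) {c : ℝ} (hc0 : 0 ≤ c) (hc1 : c < 1)
    (W : Weights m) (p : Example m) :
    c < robustLoss (rampLoss γ) B σ W p ↔
      ∃ x' ∈ B p.1, ∃ j, j ≠ p.2 ∧ net σ W x' p.2 - net σ W x' j < γ * (1 - c) := by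
  rw [robustLoss, lt_iSup_iff_of_nonneg (bddAbove_range_loss (rampLoss_mem_Icc γ) W p) hc0]
  simp only [lt_rampLoss_iff hγ hc0 hc1, Subtype.exists, exists_prop]

/-- Only countably many margins are needed to recover the superlevel sets of the ramp loss, so that
they inherit measurability. -/
theorem setOf_lt_robustLoss_rampLoss (hγ : 0 < γ) (W : Weights m) {c : ℝ} (hc0 : 0 ≤ c)
    (hc1 : c < 1) :
    {p | c < robustLoss (rampLoss γ) B σ W p}
      = ⋃ q : {q : ℚ // 0 ≤ (q : ℝ) ∧ (q : ℝ) < γ * (1 - c)}, robustMarginErrorSet B σ q.1 W := by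
  ext p
  have hpos : 0 < γ * (1 - c) := mul_pos hγ (sub_pos.2 hc1)
  simp only [Set.mem_ofPred_eq, lt_robustLoss_rampLoss_iff hγ hc0 hc1, Set.mem_iUnion,
    robustMarginErrorSet]
  constructor
  · rintro ⟨x', hx', j, hj, hlt⟩
    obtain ⟨q, hq, hqγ⟩ := exists_rat_btwn (max_lt hpos hlt)
    obtain ⟨hq0, hqj⟩ := max_lt_iff.1 hq
    exact ⟨⟨q, hq0.le, hqγ⟩, x', hx', j, hj, (sub_lt_iff_lt_add.1 hqj).le⟩
  · rintro ⟨⟨q, _, hqγ⟩, x', hx', j, hj, hle⟩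
    exact ⟨x', hx', j, hj, (sub_le_iff_le_add.2 hle).trans_lt hqγ⟩

theorem aemeasurable_robustLoss_rampLoss (hγ : 0 < γ) {D : Measure (Example m)} {W : Weights m}
    (hMeas : ∀ t ∈ Set.Icc 0 γ, NullMeasurableSet (robustMarginErrorSet B σ t W) D) :
    AEMeasurable (robustLoss (rampLoss γ) B σ W) D := by
  have h01 := robustLoss_mem_Icc (B := B) (σ := σ) (rampLoss_mem_Icc γ) W
  refine NullMeasurable.aemeasurable
    (measurable_of_Ioi (δ := NullMeasurableSpace (Example m) D) fun c => ?_)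
  change NullMeasurableSet {p | c < robustLoss (rampLoss γ) B σ W p} D
  rcases lt_or_ge c 0 with hc0 | hc0
  · rw [show {p | c < robustLoss (rampLoss γ) B σ W p} = Set.univ from
      Set.eq_univ_of_forall fun p => hc0.trans_le (h01 p).1]
    exact .univ
  rcases lt_or_ge c 1 with hc1 | hc1
  · rw [setOf_lt_robustLoss_rampLoss hγ W hc0 hc1]
    exact .iUnion fun q => hMeas _ ⟨q.2.1, q.2.2.le.trans (by nlinarith)⟩
  · rw [show {p | c < robustLoss (rampLoss γ) B σ W p} = ∅ from
      Set.eq_empty_of_forall_notMem fun p hp => (hp.trans_le (h01 p).2).not_ge hc1]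
    exact .empty

theorem one_le_robustLoss_rampLoss (hγ : 0 < γ) {W : Weights m}
    {pick : Vec (m (Fin.last L)) → Fin (m (Fin.last L))}
    (hpick : ∀ (v : Vec (m (Fin.last L))) j, v j ≤ v (pick v)) {p : Example m}
    (hp : p ∈ robustErrorSet pick B σ W) : 1 ≤ robustLoss (rampLoss γ) B σ W p := by
  obtain ⟨x', hx', hne⟩ := hp
  rw [← rampLoss_eq_one hγ hne.symm (hpick _ _)]
  exact le_ciSup (bddAbove_range_loss (rampLoss_mem_Icc γ) W p) ⟨x', hx'⟩

theorem measureReal_robustErrorSet_le (hγ : 0 < γ) {D : Measure (Example m)}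
    [IsProbabilityMeasure D] {W : Weights m}
    {pick : Vec (m (Fin.last L)) → Fin (m (Fin.last L))}
    (hpick : ∀ (v : Vec (m (Fin.last L))) j, v j ≤ v (pick v))
    (hMeas : AEMeasurable (robustLoss (rampLoss γ) B σ W) D) :
    D.real (robustErrorSet pick B σ W) ≤ ∫ p, robustLoss (rampLoss γ) B σ W p ∂D := by
  have h01 := robustLoss_mem_Icc (B := B) (σ := σ) (rampLoss_mem_Icc γ) W
  calc D.real (robustErrorSet pick B σ W)
      ≤ D.real {p | 1 ≤ robustLoss (rampLoss γ) B σ W p} :=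
        measureReal_mono fun p => one_le_robustLoss_rampLoss hγ hpick
    _ ≤ ∫ p, robustLoss (rampLoss γ) B σ W p ∂D := by
        simpa only [one_mul] using mul_meas_ge_le_integral_of_nonneg (.of_forall fun p => (h01 p).1)
          (Integrable.of_mem_Icc 0 1 hMeas (.of_forall h01)) 1

theorem robustLoss_rampLoss_le_indicator (hγ : 0 < γ) (W : Weights m) (p : Example m) :
    robustLoss (rampLoss γ) B σ W p
      ≤ (robustMarginErrorSet B σ γ W).indicator (fun _ => (1 : ℝ)) p := by
  by_cases hp : p ∈ robustMarginErrorSet B σ γ W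
  · rw [Set.indicator_of_mem hp]
    exact (robustLoss_mem_Icc (rampLoss_mem_Icc γ) W p).2
  · rw [Set.indicator_of_notMem hp]
    refine not_lt.1 fun hpos => hp ?_
    obtain ⟨x', hx', j, hj, hlt⟩ :=
      (lt_robustLoss_rampLoss_iff hγ le_rfl zero_lt_one W p).1 hpos
    exact ⟨x', hx', j, hj, by linarith⟩

theorem robustMarginGap_le_robustGap_rampLoss (hγ : 0 < γ) {D : Measure (Example m)}
    [IsProbabilityMeasure D] {W : Weights m}
    {pick : Vec (m (Fin.last L)) → Fin (m (Fin.last L))}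
    (hpick : ∀ (v : Vec (m (Fin.last L))) j, v j ≤ v (pick v))
    (hMeas : AEMeasurable (robustLoss (rampLoss γ) B σ W) D) {n : ℕ} (S : Fin n → Example m) :
    robustMarginGap pick B σ γ D S W ≤ robustGap (rampLoss γ) B σ D S W := by
  unfold robustMarginGap robustGap
  gcongr with i
  · exact measureReal_robustErrorSet_le hγ hpick hMeas
  · exact robustLoss_rampLoss_le_indicator hγ W (S i)

theorem exists_event_robustMarginGap_le (hσ : ∀ i, LipschitzWith (ρ i) (σ i))
    (hσ0 : ∀ i, σ i 0 = 0) (hs : ∀ l, 0 < s l) (ha : ∀ l, 0 ≤ a l) (hB : ∀ x, (B x).Nonempty)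
    (D : Measure (Example m)) [IsProbabilityMeasure D] {n : ℕ} (hn : 0 < n) {δ : ℝ}
    (hδ0 : 0 < δ) (hδ1 : δ < 1) (hγ : 0 < γ)
    {pick : Vec (m (Fin.last L)) → Fin (m (Fin.last L))}
    (hpick : ∀ (v : Vec (m (Fin.last L))) j, v j ≤ v (pick v))
    (hMeas : ∀ W ∈ weightClass m s a, ∀ t ∈ Set.Icc 0 γ,
      NullMeasurableSet (robustMarginErrorSet B σ t W) D) :
    ∃ E : Set (Fin n → Example m), MeasurableSet E ∧
      1 - δ ≤ (Measure.pi (fun _ : Fin n => D)).real E ∧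
      ∀ S ∈ E, ∀ W ∈ weightClass m s a, ∀ Btil : ℝ, BoundsAdversarial B S Btil →
        robustMarginGap pick B σ γ D S W ≤
          192 * (logFactor n (maxWidth m) * leadingTerm n Btil (1 / γ) (fun i => (ρ i : ℝ)) s a
            + √(Real.log (1 / δ) / n)) := by
  have hramp : ∀ W ∈ weightClass m s a, AEMeasurable (robustLoss (rampLoss γ) B σ W) D :=
    fun W hW => aemeasurable_robustLoss_rampLoss hγ (hMeas W hW)
  obtain ⟨E, hE, hEδ, hgap⟩ := exists_event_robustGap_le hσ hσ0 hs ha hB D hn hδ0 hδ1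
    (lipschitzWith_rampLoss hγ) (rampLoss_mem_Icc γ) hramp
  refine ⟨E, hE, hEδ, fun S hS W hW Btil hBtil => ?_⟩
  have hlead : leadingTerm n Btil (2 / γ).toNNReal (fun i => (ρ i : ℝ)) s a
      = 2 * leadingTerm n Btil (1 / γ) (fun i => (ρ i : ℝ)) s a := by
    rw [Real.coe_toNNReal _ (by positivity)]
    unfold leadingTerm
    ring
  calc robustMarginGap pick B σ γ D S W
      ≤ robustGap (rampLoss γ) B σ D S W :=
        robustMarginGap_le_robustGap_rampLoss hγ hpick (hramp W hW) S
    _ ≤ 96 * (logFactor n (maxWidth m) * leadingTerm n Btil (2 / γ).toNNReal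
          (fun i => (ρ i : ℝ)) s a + √(Real.log (1 / δ) / n)) := hgap S hS W hW Btil hBtil
    _ ≤ 192 * (logFactor n (maxWidth m) * leadingTerm n Btil (1 / γ) (fun i => (ρ i : ℝ)) s a
          + √(Real.log (1 / δ) / n)) := by
        rw [hlead]
        linarith [Real.sqrt_nonneg (Real.log (1 / δ) / n)]

end Margin

end RobustNet

theorem theorem1 :
    ∃ C : ℝ, 0 < C ∧
      ∀ (L : ℕ) (m : Fin (L + 1) → ℕ)
        (ρ : Fin L → ℝ≥0) (σ : RobustNet.Activations m)
        (_hσ : ∀ i, LipschitzWith (ρ i) (σ i)) (_hσ0 : ∀ i, σ i 0 = 0)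
        (s a : Fin L → ℝ) (_hs : ∀ i, 0 < s i) (_ha : ∀ i, 0 ≤ a i)
        (B : RobustNet.Vec (m 0) → Set (RobustNet.Vec (m 0))) (_hB : ∀ x, (B x).Nonempty)
        (D : Measure (RobustNet.Example m)) (_hD : IsProbabilityMeasure D)
        (n : ℕ) (_hn : 0 < n) (δ : ℝ) (_hδ0 : 0 < δ) (_hδ1 : δ < 1),
        -- generalization bound for a Lipschitz loss
        (∀ (r : ℝ≥0)
          (loss : RobustNet.Vec (m (Fin.last L)) → Fin (m (Fin.last L)) → ℝ)
          (_hLip : ∀ y, LipschitzWith r (fun v => loss v y))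
          (_hRange : ∀ v y, loss v y ∈ Set.Icc (0 : ℝ) 1)
          (_hMeas : ∀ W ∈ RobustNet.weightClass m s a,
            AEMeasurable (RobustNet.robustLoss loss B σ W) D),
          ∃ E : Set (Fin n → RobustNet.Example m), MeasurableSet E ∧
            1 - δ ≤ (Measure.pi (fun _ : Fin n => D)).real E ∧
            ∀ S ∈ E, ∀ W ∈ RobustNet.weightClass m s a, ∀ Btil : ℝ,
              RobustNet.BoundsAdversarial B S Btil →
              RobustNet.robustGap loss B σ D S W ≤
                C * (RobustNet.logFactor n (RobustNet.maxWidth m) *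
                    RobustNet.leadingTerm n Btil r (fun i => (ρ i : ℝ)) s a
                  + √(Real.log (1 / δ) / n))) ∧
        -- margin bound
        (∀ (γ : ℝ) (_hγ : 0 < γ)
          (pick : RobustNet.Vec (m (Fin.last L)) → Fin (m (Fin.last L)))
          (_hpick : ∀ (v : RobustNet.Vec (m (Fin.last L))) j, v j ≤ v (pick v))
          (_hMeas : ∀ W ∈ RobustNet.weightClass m s a, ∀ t ∈ Set.Icc 0 γ,
            NullMeasurableSet (RobustNet.robustMarginErrorSet B σ t W) D),
          ∃ E : Set (Fin n → RobustNet.Example m), MeasurableSet E ∧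
            1 - δ ≤ (Measure.pi (fun _ : Fin n => D)).real E ∧
            ∀ S ∈ E, ∀ W ∈ RobustNet.weightClass m s a, ∀ Btil : ℝ,
              RobustNet.BoundsAdversarial B S Btil →
              RobustNet.robustMarginGap pick B σ γ D S W ≤
                C * (RobustNet.logFactor n (RobustNet.maxWidth m) *
                    RobustNet.leadingTerm n Btil (1 / γ) (fun i => (ρ i : ℝ)) s a
                  + √(Real.log (1 / δ) / n))) := by
  refine ⟨192, by norm_num, fun L m ρ σ hσ hσ0 s a hs ha B hB D hD n hn δ hδ0 hδ1 =>
    ⟨fun r loss hLip hRange hMeas => ?_, fun γ hγ pick hpick hMeas =>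
      RobustNet.exists_event_robustMarginGap_le hσ hσ0 hs ha hB D hn hδ0 hδ1 hγ hpick hMeas⟩⟩
  obtain ⟨E, hE, hEδ, hgap⟩ :=
    RobustNet.exists_event_robustGap_le hσ hσ0 hs ha hB D hn hδ0 hδ1 hLip hRange hMeas
  refine ⟨E, hE, hEδ, fun S hS W hW Btil hBtil => (hgap S hS W hW Btil hBtil).trans ?_⟩
  have hnonneg := RobustNet.logFactor_mul_leadingTerm_nonneg (n := n) (ρ := ρ)
    (M := RobustNet.maxWidth m) (hBtil.nonneg hB hn) r.2 hs ha
  gcongr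
  norm_num
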